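/- Let $(W,S)_B$ be a geometric Coxeter system of finite rank $n=|S|$: a Coxeter system with orders $m_{st}$, together with the matrix $B_{st}=-\cos(\pi/m_{st})$ if $m_{st}<\infty$ and $B_{st}=-c_{st}$ with some $c_{st}=c_{ts}\ge 1$ if $m_{st}=\infty$. Let $\mathcal B$ be the bilinear form on $V=\mathbb R^S$ with $\mathcal B(\alpha_s,\alpha_t)=B_{st}$ on the standard basis $(\alpha_s)$, on which $W$ acts by $s(x)=x-2\mathcal B(x,\alpha_s)\alpha_s$. Assume that - the system is irreducible (the Coxeter graph is connected); - it is Lorentzian ($\mathcal B$ has signature $(n-1,1)$); - it is of level $2$: every principal submatrix of $B$ on $n-2$ indices is positive semidefinite, but not every one on $n-1$ indices is. Let $Q=\{x:\mathcal B(x,x)=0\}$, let $(\omega_s)$ be the basis of $V$ with $\mathcal B(\alpha_s,\omega_t)=\delta_{st}$, let $\Omega=\{w(\omega_s)\}$ be the set of weights, and let $T$ (the Tits cone) be the closed convex cone spanned by $\Omega$. For $X\subseteq V$ write $\widehat X$ for the set of points of $\mathbb PV$ spanned by nonzero elements of $X$. Call a light-like vector future-directed if $h(x)>0$, where $h(x)=\sum_s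 c_sx_s$ is a sum of the coordinates with positive weights $c_s$ for which $\{h=0\}\cap Q=\{0\}$. The ball of a space-like weight $\omega$ (that is, $\mathcal B(\omega,\omega)>0$) is the set of points of $\widehat Q$ spanned by future-directed $x\in Q$ with $\mathcal B(\omega,x)\le 0$; the Boyd–Maxwell packing $\mathscr P$ is the set of the balls of all space-like weights, and its tangency graph has the balls as vertices, two distinct balls being adjacent if they meet in exactly one point. A vertex of $\widehat T$ is a point of $\widehat T$ at which the normal cone has full dimension, i.e. such that the supporting hyperplanes of $T$ through it have no other point of $\mathbb PV$ in common. An edge of $\widehat T$ is a one-dimensional face (a two-dimensional face of the cone $T$). The $1$-skeleton of $\widehat T$ is the graph on the vertices of $\widehat T$ in which two distinct vertices are adjacent if they lie on a common edge. Then $\widehat T$ is an edge-tangent infinite polytope whose $1$-skeleton is the tangency graph of $\mathscr P$: 1. $\widehat T$ has infinitely many vertices, and $T$ is the closed convex cone spanned by the vertices. 2. Every edge of $\widehat T$ is tangent to $\widehat Q$: the projective line spanned by the edge meets $\widehat Q$ in exactly one point, and this point lies on the edge. 3. There is an isomorphism from the tangency graph of $\mathscr P$ onto the $1$-skeleton of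 $\widehat T$ that sends the ball of each space-like weight $\omega$ to the point of $\mathbb PV$ spanned by $\omega$. -/

import Mathlib

open scoped LinearAlgebra.Projectivization Matrix

noncomputable section

/-! ### Convex cones seen in projective space -/

section ProjectiveCones

variable {E : Type*} [AddCommGroup E] [Module ℝ E]

/-- The projective set of lines spanned by the nonzero vectors of `X`. -/
def projSet (X : Set E) : Set (ℙ ℝ E) :=
  {p | ∃ x ∈ X, ∃ hx : x ≠ 0, Projectivization.mk ℝ x hx = p}

/-- The vertices of the projective convex set given by the cone `T`: the points `p` of it at which
the normal cone has full dimension, i.e. the supporting hyperplanes of `T` through `p` have no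
point other than `p` in common. (A smooth boundary point, for instance an extreme point with only
one supporting hyperplane, is not a vertex. For a polyhedral cone, these are the usual vertices.) -/
def projVertices (T : PointedCone ℝ E) : Set (ℙ ℝ E) :=
  {p | p ∈ projSet (T : Set E) ∧
    ∀ y : E,
      (∀ f : Module.Dual ℝ E, (∀ z ∈ T, 0 ≤ f z) → (∀ x ∈ p.submodule, f x = 0) → f y = 0) →
      y ∈ p.submodule}

/-- `F` is a one-dimensional face of the projective convex set given by the cone `T`: a face of the
cone `T` with a two-dimensional linear span. -/
def IsProjEdge (T F : PointedCone ℝ E) : Prop :=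
  F.IsFaceOf T ∧ Module.finrank ℝ (Submodule.span ℝ (F : Set E)) = 2

/-- The `1`-skeleton of the projective convex set given by the cone `T`: two distinct vertices are
adjacent if they lie on a common edge (they are then its two ends). -/
def projSkeleton (T : PointedCone ℝ E) : SimpleGraph (projVertices T) where
  Adj p q := p ≠ q ∧ ∃ F : PointedCone ℝ E, IsProjEdge T F ∧
    (p : ℙ ℝ E) ∈ projSet (F : Set E) ∧ (q : ℙ ℝ E) ∈ projSet (F : Set E)
  symm := ⟨fun _ _ ⟨h, F, hF, hp, hq⟩ => ⟨h.symm, F, hF, hq, hp⟩⟩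
  loopless := ⟨fun _ h => h.1 rfl⟩

end ProjectiveCones

/-- The tangency graph of a set of closed balls with disjoint interiors: two distinct balls are
adjacent if they touch in exactly one point. -/
def tangencyGraph {X : Type*} (P : Set (Set X)) : SimpleGraph P where
  Adj b b' := b ≠ b' ∧ ∃ p : X, (b : Set X) ∩ b' = {p}
  symm := ⟨fun _ _ ⟨h, p, hp⟩ => ⟨h.symm, p, by rw [Set.inter_comm]; exact hp⟩⟩
  loopless := ⟨fun _ h => h.1 rfl⟩

/-! ### Geometric Coxeter systems -/

/-- The data of a geometric Coxeter system: a Coxeter matrix `M` (where the entry `0` stands for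
`∞`), with a number `c s t = c t s ≥ 1` for every pair with `M s t = ∞`. -/
structure GeometricCoxeterMatrix (S : Type*) where
  M : CoxeterMatrix S
  c : S → S → ℝ
  c_symm : ∀ s t, M s t = 0 → c s t = c t s
  one_le_c : ∀ s t, M s t = 0 → 1 ≤ c s t

namespace GeometricCoxeterMatrix

variable {S : Type*} (G : GeometricCoxeterMatrix S)

/-- The matrix `B`. -/
def gram : Matrix S S ℝ :=
  fun s t => if G.M s t = 0 then -G.c s t else -Real.cos (Real.pi / G.M s t)

theorem gram_self (s : S) : G.gram s s = 1 := by
  simp [gram]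

theorem gram_comm (s t : S) : G.gram s t = G.gram t s := by
  unfold gram
  rw [G.M.symmetric t s]
  split_ifs with h
  · rw [G.c_symm s t h]
  · rfl

/-- The Coxeter graph, without its labels. -/
def coxeterGraph : SimpleGraph S where
  Adj s t := s ≠ t ∧ G.M s t ≠ 2
  symm := ⟨fun s t h => ⟨h.1.symm, by rw [G.M.symmetric t s]; exact h.2⟩⟩
  loopless := ⟨fun _ h => h.1 rfl⟩

/-- The Coxeter system is irreducible. -/
def IsIrreducible : Prop := G.coxeterGraph.Connected

variable [Fintype S]

/-- The Coxeter graph is of level `≤ r`: every induced subgraph on `n - r` vertices is of finite or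
affine type, i.e. has a positive semidefinite matrix. -/
def LevelLE (r : ℕ) : Prop :=
  ∀ I : Finset S, I.card + r = Fintype.card S →
    (G.gram.submatrix (Subtype.val : I → S) (Subtype.val : I → S)).PosSemidef

/-- The Coxeter graph is of level `r`. -/
def IsOfLevel (r : ℕ) : Prop := G.LevelLE r ∧ ∀ r' < r, ¬ G.LevelLE r'

variable [DecidableEq S]

/-- The bilinear form `𝓑` on `V = ℝ^S`. -/
def form : LinearMap.BilinForm ℝ (S → ℝ) := Matrix.toBilin' G.gram

/-- The Coxeter system is of Lorentzian type: `𝓑` has signature `(n - 1, 1)`. -/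
def IsLorentzian : Prop :=
  sigPos G.form.toQuadraticMap + 1 = Fintype.card S ∧
    sigNeg G.form.toQuadraticMap = 1

/-- The light cone `Q`. -/
def lightCone : Set (S → ℝ) := {x | G.form x x = 0}

/-- The simple roots: the standard basis of `V = ℝ^S`. -/
def simpleRoot (s : S) : S → ℝ := Pi.single s 1

/-- The linear form `x ↦ 2 𝓑(x, α_s)`, where `𝓑(α_s, α_s) = 1`. -/
def coroot (s : S) : Module.Dual ℝ (S → ℝ) := (2 : ℝ) • G.form.flip (simpleRoot s)

theorem form_simpleRoot (s t : S) : G.form (simpleRoot s) (simpleRoot t) = G.gram s t := by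
  simp [form, simpleRoot]

theorem coroot_simpleRoot (s t : S) : G.coroot s (simpleRoot t) = 2 * G.gram s t := by
  simp [coroot, form_simpleRoot, G.gram_comm s t]

theorem coroot_self (s : S) : G.coroot s (simpleRoot s) = 2 := by
  rw [coroot_simpleRoot, gram_self, mul_one]

/-- The reflection `σ_s(x) = x - 2 𝓑(x, α_s) α_s`. -/
def simpleReflection (s : S) : (S → ℝ) ≃ₗ[ℝ] (S → ℝ) := Module.reflection (G.coroot_self s)

theorem simpleReflection_apply (s : S) (x : S → ℝ) :
    G.simpleReflection s x = x - (2 * G.form x (simpleRoot s)) • simpleRoot s := by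
  simp [simpleReflection, Module.reflection_apply, coroot]

theorem isLiftable : G.M.IsLiftable G.simpleReflection := by
  intro i j
  by_cases h0 : G.M i j = 0
  · rw [h0, pow_zero]
  by_cases hij : i = j
  · subst hij
    rw [G.M.diagonal, pow_one]
    exact LinearEquiv.ext fun x => Module.involutive_reflection (G.coroot_self i) x
  have h1 : G.M i j ≠ 1 := G.M.off_diagonal i j hij
  have hg : G.gram i j = -Real.cos (Real.pi / G.M i j) := by simp [gram, h0]
  refine LinearEquiv.ext fun z => ?_
  unfold simpleReflection
  rw [Module.reflection_mul_reflection_pow_apply]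
  rw [G.coroot_simpleRoot, G.coroot_simpleRoot, G.gram_comm j i]
  generalize hm : G.M i j = m at *
  by_cases h2 : m = 2
  · subst h2
    have hz : G.gram i j = 0 := by rw [hg]; norm_num
    rw [hz]
    norm_num
    abel
  set θ : ℝ := 2 * (Real.pi / m) with hθ
  have ht : 2 * G.gram i j * (2 * G.gram i j) - 2 = 2 * Real.cos θ := by
    rw [hg, hθ, Real.cos_two_mul]; ring
  have hm3 : 3 ≤ m := by omega
  have hmR : (3 : ℝ) ≤ m := by exact_mod_cast hm3
  have hmθ : (m : ℝ) * θ = 2 * Real.pi := by rw [hθ]; field_simp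
  have hs : Real.sin θ ≠ 0 := by
    apply ne_of_gt
    apply Real.sin_pos_of_pos_of_lt_pi
    · rw [hθ]; have := Real.pi_pos; positivity
    · have h3 : 0 < θ := by rw [hθ]; have := Real.pi_pos; positivity
      nlinarith [Real.pi_pos]
  rw [ht]
  have hS := fun n : ℤ => Polynomial.Chebyshev.S_two_mul_real_cos θ n
  obtain ⟨k, hk | hk⟩ := Nat.even_or_odd' m
  · have e1 : ((m : ℤ) - 2) / 2 = k - 1 := by omega
    have e2 : ((m : ℤ) - 1) / 2 = k - 1 := by omega
    have hz : (Polynomial.Chebyshev.S ℝ ((k : ℤ) - 1)).eval (2 * Real.cos θ) = 0 := by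
      have h := hS ((k : ℤ) - 1)
      have : (((k : ℤ) - 1 : ℤ) + 1 : ℝ) * θ = Real.pi := by
        have : (m : ℝ) = 2 * k := by exact_mod_cast hk
        rw [this] at hmθ
        push_cast; linarith
      rw [this, Real.sin_pi] at h
      exact (mul_eq_zero.mp h).resolve_right hs
    rw [e1, e2, hz]
    simp
  · have e1 : ((m : ℤ) - 2) / 2 = k - 1 := by omega
    have e2 : ((m : ℤ) - 1) / 2 = k := by omega
    have e3 : ((m : ℤ) - 3) / 2 = k - 1 := by omega
    have e4 : (m : ℤ) / 2 = k := by omega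
    have hz : (Polynomial.Chebyshev.S ℝ (k : ℤ)).eval (2 * Real.cos θ) +
        (Polynomial.Chebyshev.S ℝ ((k : ℤ) - 1)).eval (2 * Real.cos θ) = 0 := by
      have h := hS (k : ℤ)
      have h' := hS ((k : ℤ) - 1)
      have e : (((k : ℤ) : ℝ) + 1) * θ = 2 * Real.pi - k * θ := by
        have : (m : ℝ) = 2 * k + 1 := by exact_mod_cast hk
        rw [this] at hmθ
        push_cast; linarith
      rw [e, Real.sin_two_pi_sub] at h
      have e' : (((k : ℤ) - 1 : ℤ) + 1 : ℝ) * θ = k * θ := by push_cast; ring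
      rw [e'] at h'
      refine (mul_eq_zero.mp ?_).resolve_right hs
      rw [add_mul, h, h']; ring
    rw [e1, e2, e3, e4, hz]
    simp

/-- The fundamental weights: `ω_s` is the `s`-th column of `B⁻¹`. -/
def fundamentalWeight (s : S) : S → ℝ := (G.gram⁻¹) *ᵥ simpleRoot s

theorem form_simpleRoot_fundamentalWeight (hB : IsUnit G.gram.det) (s t : S) :
    G.form (simpleRoot s) (G.fundamentalWeight t) = if s = t then 1 else 0 := by
  rw [form, Matrix.toBilin'_apply', fundamentalWeight, Matrix.mulVec_mulVec,
    Matrix.mul_nonsing_inv _ hB, Matrix.one_mulVec]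
  simp [simpleRoot, Pi.single_apply, eq_comm]

/-- `c` gives a height function `h(x) = ∑ c_s x_s`: a positively weighted sum of the coordinates,
such that the hyperplane `h = 0` meets the light cone only at the origin. -/
def IsHeight (c : S → ℝ) : Prop :=
  (∀ s, 0 < c s) ∧ ∀ x ∈ G.lightCone, ∑ s, c s * x s = 0 → x = 0

/-- A vector is future-directed if it has positive height. -/
def FutureDirected (x : S → ℝ) : Prop := ∃ c, G.IsHeight c ∧ 0 < ∑ s, c s * x s

/-- The ball of a space-like vector `ω`: the closed cap cut out of the projective light cone by the
half-space `𝓑(ω, x) ≤ 0`, where a point of the projective light cone is represented by a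
future-directed vector `x`. -/
def ball (ω : S → ℝ) : Set (ℙ ℝ (S → ℝ)) :=
  projSet {x | x ∈ G.lightCone ∧ G.FutureDirected x ∧ G.form ω x ≤ 0}

variable {G} {W : Type*} [Group W] (cs : CoxeterSystem G.M W)

/-- The geometric representation of the Coxeter group `W` on `V = ℝ^S`. -/
def geometricRep : W →* ((S → ℝ) ≃ₗ[ℝ] (S → ℝ)) :=
  cs.lift ⟨G.simpleReflection, G.isLiftable⟩

/-- The weights. -/
def weights : Set (S → ℝ) := {x | ∃ (w : W) (s : S), x = geometricRep cs w (G.fundamentalWeight s)}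

/-- The space-like weights. -/
def spaceLikeWeights : Set (S → ℝ) := {ω | ω ∈ weights cs ∧ 0 < G.form ω ω}

/-- The Tits cone: the closed convex cone spanned by the weights. -/
def titsCone : PointedCone ℝ (S → ℝ) := (PointedCone.hull ℝ (weights cs)).closure

/-- The Boyd–Maxwell packing: the set of balls of the space-like weights. -/
def boydMaxwell : Set (Set (ℙ ℝ (S → ℝ))) := G.ball '' spaceLikeWeights cs

end GeometricCoxeterMatrix

end

/-!
Fix a Perron vector `v` of the Gram matrix; it is time-like and lies in the chamber opposite to the
fundamental one. Since `w x ≤ x` for `x` in the fundamental chamber, every nonzero point of the Tits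
cone `T` lies strictly on the past side of `v`.

Two descent arguments give all the geometry of `T`. First, level two makes the component of a
fundamental weight orthogonal to a space-like weight `ω` causal, and minimizing over the chamber of
the stabilizer of `ω` extends this to all of `T`: orthogonally to `ω`, the cone `T` projects into
the past light cone. Secondly, minimizing over the fundamental chamber shows that the dual of the
set of space-like weights is causal; so the closed convex cone generated by the space-like weights
contains the past light cone, hence also the remaining weights, and is equal to `T`.

The rest is convex geometry of such a cone. Seen from a space-like weight `ω`, the cone `T` fills
the past light cone of the complement of `ω`: a second space-like weight `ω'` lies on a common edge
with `ω` exactly when its component orthogonal to `ω` is light-like, which is also the condition for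
the two balls to meet in one point, namely the point spanned by that component.
-/

noncomputable section

/-! ### Orthogonal projections and Lorentz forms -/

section OrthogonalProjection

variable {E : Type*} [AddCommGroup E] [Module ℝ E]

/-- The orthogonal projection, with respect to the bilinear form `B`, onto the complement of a
non-isotropic vector `x`; it is the identity when `B x x = 0`. -/
def orthProj (B : LinearMap.BilinForm ℝ E) (x : E) : E →ₗ[ℝ] E :=
  LinearMap.id - ((B x x)⁻¹ • B.flip x).smulRight x

variable {B : LinearMap.BilinForm ℝ E} {x : E}

theorem orthProj_apply (B : LinearMap.BilinForm ℝ E) (x y : E) :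
    orthProj B x y = y - (B y x / B x x) • x := by
  simp [orthProj, div_eq_inv_mul]

theorem eq_smul_add_orthProj (B : LinearMap.BilinForm ℝ E) (x y : E) :
    y = (B y x / B x x) • x + orthProj B x y := by
  rw [orthProj_apply]; abel

theorem form_orthProj (hx : B x x ≠ 0) (y : E) : B (orthProj B x y) x = 0 := by
  simp [orthProj_apply, hx]

theorem form_eq_form_orthProj {z : E} (hz : B z x = 0) (y : E) : B z y = B z (orthProj B x y) := by
  simp [orthProj_apply, hz]

theorem form_orthProj_self (hx : B x x ≠ 0) (y : E) :
    B (orthProj B x y) (orthProj B x y) = B (orthProj B x y) y :=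
  (form_eq_form_orthProj (form_orthProj hx y) y).symm

theorem orthProj_ne_zero {y : E} (hxy : ∀ c : ℝ, y ≠ c • x) : orthProj B x y ≠ 0 := fun h =>
  hxy _ (by rw [orthProj_apply, sub_eq_zero] at h; exact h)

theorem linearIndependent_pair_of_orthogonal {y : E} (hx : B x x ≠ 0) (hy : y ≠ 0)
    (hyx : B y x = 0) : LinearIndependent ℝ ![x, y] := by
  refine LinearIndependent.pair_iff.2 fun a b hab => ?_
  have ha : a = 0 := by simpa [hyx, hx] using congrArg (fun z => B z x) hab
  subst ha
  simpa [hy] using hab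

theorem finrank_span_pair_of_orthogonal {y : E} (hx : B x x ≠ 0) (hy : y ≠ 0) (hyx : B y x = 0) :
    Module.finrank ℝ (Submodule.span ℝ {x, y}) = 2 := by
  rw [← Matrix.range_cons_cons_empty]
  exact finrank_span_eq_card (linearIndependent_pair_of_orthogonal hx hy hyx)

theorem form_add_smul_self (hB : B.IsSymm) (x y : E) (t : ℝ) :
    B (x + t • y) (x + t • y) = B x x + 2 * t * B x y + t ^ 2 * B y y := by
  have hyx : B y x = B x y := hB.eq y x
  simp only [map_add, map_smul, LinearMap.add_apply, LinearMap.smul_apply, smul_eq_mul, hyx]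
  ring

theorem form_add_self (hB : B.IsSymm) (x y : E) :
    B (x + y) (x + y) = B x x + 2 * B x y + B y y := by
  simpa using form_add_smul_self hB x y 1

theorem exists_ne_zero_of_two_functionals [FiniteDimensional ℝ E] (hE : 3 ≤ Module.finrank ℝ E)
    (f g : Module.Dual ℝ E) : ∃ u : E, u ≠ 0 ∧ f u = 0 ∧ g u = 0 := by
  have hker : LinearMap.ker (f.prod g) ≠ ⊥ := LinearMap.ker_ne_bot_of_finrank_lt (by simp; omega)
  obtain ⟨u, hu, hu0⟩ := Submodule.exists_mem_ne_zero_of_ne_bot hker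
  exact ⟨u, hu0, Prod.mk_eq_zero.1 (LinearMap.mem_ker.1 hu)⟩

end OrthogonalProjection

/-- A symmetric bilinear form with exactly one negative direction: some vector has negative norm,
and the form is positive definite on the orthogonal complement of every such vector. In finite
dimension this is signature `(n - 1, 1)`. -/
structure IsLorentzForm {E : Type*} [AddCommGroup E] [Module ℝ E] (B : LinearMap.BilinForm ℝ E) :
    Prop where
  isSymm : B.IsSymm
  exists_neg : ∃ x, B x x < 0
  pos_of_orthogonal : ∀ {x y}, B x x < 0 → B x y = 0 → y ≠ 0 → 0 < B y y

/-- The past light cone: the causal vectors on the same side as `-v`, where `v` is a time-like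
vector that fixes the time orientation. -/
def pastCone {E : Type*} [AddCommGroup E] [Module ℝ E] (B : LinearMap.BilinForm ℝ E) (v : E) :
    Set E :=
  {x | B x x ≤ 0 ∧ 0 ≤ B x v}

namespace IsLorentzForm

variable {E : Type*} [AddCommGroup E] [Module ℝ E] {B : LinearMap.BilinForm ℝ E} {v x y : E}

theorem symm (hB : IsLorentzForm B) (x y : E) : B x y = B y x :=
  hB.isSymm.eq x y

theorem orthogonal_nonneg (hB : IsLorentzForm B) (hx : B x x < 0) (hxy : B x y = 0) :
    0 ≤ B y y := by
  rcases eq_or_ne y 0 with rfl | hy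
  · simp
  · exact (hB.pos_of_orthogonal hx hxy hy).le

theorem eq_zero_of_orthogonal (hB : IsLorentzForm B) (hx : B x x < 0) (hxy : B x y = 0)
    (hy : B y y ≤ 0) : y = 0 := by
  by_contra hy0
  exact (hB.pos_of_orthogonal hx hxy hy0).not_ge hy

theorem eq_zero_of_forall (hB : IsLorentzForm B) (hx : ∀ y, B x y = 0) : x = 0 := by
  obtain ⟨z, hz⟩ := hB.exists_neg
  exact hB.eq_zero_of_orthogonal hz (by rw [hB.symm, hx]) (hx x).le

theorem exists_form_eq [FiniteDimensional ℝ E] (hB : IsLorentzForm B) (f : Module.Dual ℝ E) :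
    ∃ y, ∀ x, B y x = f x := by
  have hinj : Function.Injective B :=
    (injective_iff_map_eq_zero B).2 fun x hx => hB.eq_zero_of_forall fun y => by simp [hx]
  obtain ⟨y, rfl⟩ := (LinearMap.injective_iff_surjective_of_finrank_eq_finrank
    Subspace.dual_finrank_eq.symm).1 hinj f
  exact ⟨y, fun _ => rfl⟩

theorem form_orthProj_self_neg (hB : IsLorentzForm B) (hx : 0 < B x x) (hy : B y y < 0) :
    B (orthProj B x y) (orthProj B x y) < 0 := by
  have hval : B (orthProj B x y) y = B y y - B y x ^ 2 / B x x := by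
    simp only [orthProj_apply, map_sub, map_smul, LinearMap.sub_apply, LinearMap.smul_apply,
      smul_eq_mul, hB.symm x y]
    ring
  have hsq : 0 ≤ B y x ^ 2 / B x x := by positivity
  linarith [form_orthProj_self hx.ne' y]

theorem exists_lightlike (hB : IsLorentzForm B) (hx : B x x < 0) (hy : y ≠ 0) (hxy : B x y = 0) :
    ∃ t : ℝ, 0 < t ∧ B (x + t • y) (x + t • y) = 0 ∧ B (x + -t • y) (x + -t • y) = 0 := by
  have hyy := hB.pos_of_orthogonal hx hxy hy
  have hratio : 0 < -B x x / B y y := div_pos (by linarith) hyy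
  have hsq : √(-B x x / B y y) ^ 2 * B y y = -B x x := by
    rw [Real.sq_sqrt hratio.le]; field_simp
  refine ⟨√(-B x x / B y y), Real.sqrt_pos.2 hratio, ?_, ?_⟩ <;>
    rw [form_add_smul_self hB.isSymm, hxy] <;> linear_combination hsq

theorem form_self_neg_of_forall_lightlike [FiniteDimensional ℝ E] (hB : IsLorentzForm B)
    (hE : 3 ≤ Module.finrank ℝ E) (hx0 : x ≠ 0)
    (hx : ∀ y, B y y = 0 → B x y = 0 → y = 0) : B x x < 0 := by
  by_contra! hxx
  rcases hxx.eq_or_lt with hxx | hxx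
  · exact hx0 (hx x hxx.symm hxx.symm)
  obtain ⟨e, hee, hxe⟩ : ∃ e, B e e < 0 ∧ B x e = 0 := by
    obtain ⟨z, hz⟩ := hB.exists_neg
    exact ⟨orthProj B x z, hB.form_orthProj_self_neg hxx hz,
      by rw [hB.symm, form_orthProj hxx.ne']⟩
  obtain ⟨w, hw0, hew, hxw⟩ := exists_ne_zero_of_two_functionals hE (B e) (B x)
  obtain ⟨t, -, hlight, -⟩ := hB.exists_lightlike hee hw0 hew
  have hzero := hx _ hlight (by simp [hxe, hxw])
  exact hee.ne (by simpa [hew] using congrArg (B e) hzero)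

section PastCone

theorem form_pos_of_mem_pastCone (hB : IsLorentzForm B) (hv : B v v < 0) (hx : x ∈ pastCone B v)
    (hx0 : x ≠ 0) : 0 < B x v := by
  refine lt_of_le_of_ne hx.2 fun h => hx0 ?_
  exact hB.eq_zero_of_orthogonal hv (by rw [hB.symm, ← h]) hx.1

theorem neg_mem_pastCone_self (hv : B v v < 0) : -v ∈ pastCone B v :=
  ⟨by simpa using hv.le, by simpa using hv.le⟩

theorem form_smul_sub_smul_self (hB : IsLorentzForm B) :
    B (B y v • x - B x v • y) (B y v • x - B x v • y) =
      B y v ^ 2 * B x x - 2 * (B x v * B y v) * B x y + B x v ^ 2 * B y y := by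
  simp only [map_sub, map_smul, LinearMap.sub_apply, LinearMap.smul_apply, smul_eq_mul,
    hB.symm y x]
  ring

theorem form_smul_sub_smul_orthogonal (hB : IsLorentzForm B) :
    B v (B y v • x - B x v • y) = 0 := by
  rw [map_sub, map_smul, map_smul, hB.symm v x, hB.symm v y, smul_eq_mul, smul_eq_mul]
  ring

theorem form_nonpos_of_mem_pastCone (hB : IsLorentzForm B) (hv : B v v < 0)
    (hx : x ∈ pastCone B v) (hy : y ∈ pastCone B v) : B x y ≤ 0 := by
  rcases eq_or_ne x 0 with rfl | hx0
  · simp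
  rcases eq_or_ne y 0 with rfl | hy0
  · simp
  have hcomb := hB.orthogonal_nonneg hv (hB.form_smul_sub_smul_orthogonal (x := x) (y := y))
  rw [hB.form_smul_sub_smul_self] at hcomb
  have hprod := mul_pos (hB.form_pos_of_mem_pastCone hv hx hx0)
    (hB.form_pos_of_mem_pastCone hv hy hy0)
  have hxx : B y v ^ 2 * B x x ≤ 0 := mul_nonpos_of_nonneg_of_nonpos (sq_nonneg _) hx.1
  have hyy : B x v ^ 2 * B y y ≤ 0 := mul_nonpos_of_nonneg_of_nonpos (sq_nonneg _) hy.1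
  by_contra! hxy
  nlinarith [mul_pos hprod hxy]

theorem exists_eq_smul_of_mem_pastCone (hB : IsLorentzForm B) (hv : B v v < 0)
    (hx : x ∈ pastCone B v) (hy : y ∈ pastCone B v) (hx0 : x ≠ 0) (hxy : B x y = 0) :
    ∃ c : ℝ, y = c • x := by
  have hxv := hB.form_pos_of_mem_pastCone hv hx hx0
  have hcomb : B y v • x - B x v • y = 0 := by
    refine hB.eq_zero_of_orthogonal hv hB.form_smul_sub_smul_orthogonal ?_
    have hxx : B y v ^ 2 * B x x ≤ 0 := mul_nonpos_of_nonneg_of_nonpos (sq_nonneg _) hx.1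
    have hyy : B x v ^ 2 * B y y ≤ 0 := mul_nonpos_of_nonneg_of_nonpos (sq_nonneg _) hy.1
    rw [hB.form_smul_sub_smul_self, hxy]
    linarith
  refine ⟨B y v / B x v, ?_⟩
  rw [div_eq_inv_mul, mul_smul, sub_eq_zero.1 hcomb, inv_smul_smul₀ hxv.ne']

theorem add_mem_pastCone (hB : IsLorentzForm B) (hv : B v v < 0) (hx : x ∈ pastCone B v)
    (hy : y ∈ pastCone B v) : x + y ∈ pastCone B v := by
  refine ⟨?_, ?_⟩
  · rw [form_add_self hB.isSymm]
    linarith [hx.1, hy.1, hB.form_nonpos_of_mem_pastCone hv hx hy]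
  · rw [map_add, LinearMap.add_apply]
    exact add_nonneg hx.2 hy.2

theorem smul_mem_pastCone {c : ℝ} (hc : 0 ≤ c) (hx : x ∈ pastCone B v) : c • x ∈ pastCone B v := by
  refine ⟨?_, ?_⟩
  · simpa using mul_nonpos_of_nonneg_of_nonpos hc (mul_nonpos_of_nonneg_of_nonpos hc hx.1)
  · simpa using mul_nonneg hc hx.2

theorem mem_pastCone_of_form_nonneg {u : E} (hB : IsLorentzForm B) (hv : B v v < 0)
    (hx : B x x ≤ 0) (hu : B u u < 0) (huv : B u v ≤ 0) (hxu : 0 ≤ B x u) : x ∈ pastCone B v := by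
  refine ⟨hx, ?_⟩
  by_contra! hxv
  have hnx : -x ∈ pastCone B v := ⟨by simpa using hx, by simpa using hxv.le⟩
  have hnu : -u ∈ pastCone B v := ⟨by simpa using hu.le, by simpa using huv⟩
  have hle : B x u ≤ 0 := by simpa using hB.form_nonpos_of_mem_pastCone hv hnx hnu
  have hx0 : x = 0 := hB.eq_zero_of_orthogonal hu (by rw [hB.symm]; exact hle.antisymm hxu) hx
  simp [hx0] at hxv

theorem exists_add_smul_mem_pastCone (hB : IsLorentzForm B) (hv : B v v < 0)
    (hx : x ∈ pastCone B v) (hxx : B x x < 0) (y : E) :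
    ∃ ε : ℝ, 0 < ε ∧ x + ε • y ∈ pastCone B v ∧ x + -ε • y ∈ pastCone B v := by
  have hxv := hB.form_pos_of_mem_pastCone hv hx (by rintro rfl; simp at hxx)
  have hself : Continuous fun t : ℝ => B x x + 2 * t * B x y + t ^ 2 * B y y := by fun_prop
  have hside : Continuous fun t : ℝ => B x v + t * B y v := by fun_prop
  have hnear : ∀ᶠ t in nhds (0 : ℝ), x + t • y ∈ pastCone B v := by
    filter_upwards [(hself.tendsto 0).eventually_lt_const (u := 0) (by simpa using hxx),
      (hside.tendsto 0).eventually_const_lt (u := 0) (by simpa using hxv)] with t ht ht'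
    exact ⟨by rw [form_add_smul_self hB.isSymm]; exact ht.le, by simpa using ht'.le⟩
  obtain ⟨δ, hδ, hball⟩ := Metric.eventually_nhds_iff.1 hnear
  have hhalf : |δ| / 2 < δ := by rw [abs_of_pos hδ]; linarith
  exact ⟨δ / 2, by positivity, hball (by simpa using hhalf), hball (by simpa using hhalf)⟩

theorem exists_mem_pastCone_orthogonal (hB : IsLorentzForm B) (hv : B v v < 0) (hx : 0 < B x x) :
    ∃ e ∈ pastCone B v, B e x = 0 ∧ B e e < 0 := by
  have hneg := hB.form_orthProj_self_neg hx (y := -v) (by simpa using hv)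
  have hside := form_orthProj_self hx.ne' (-v)
  rw [map_neg (B _)] at hside
  exact ⟨orthProj B x (-v), ⟨hneg.le, by linarith⟩, form_orthProj hx.ne' _, hneg⟩

/-- One half of the self-duality of the past cone. -/
theorem neg_mem_pastCone_of_forall_nonneg (hB : IsLorentzForm B) (hv : B v v < 0)
    (hy : ∀ x ∈ pastCone B v, 0 ≤ B y x) : -y ∈ pastCone B v := by
  have hyv : 0 ≤ B (-y) v := by simpa using hy _ (neg_mem_pastCone_self hv)
  refine ⟨?_, hyv⟩
  by_contra! hneg
  have hyy : 0 < B y y := by simpa using hneg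
  obtain ⟨e, he, hey, hee⟩ := hB.exists_mem_pastCone_orthogonal hv hyy
  obtain ⟨ε, hε, -, hmem⟩ := hB.exists_add_smul_mem_pastCone hv he hee y
  have hnonneg := hy _ hmem
  rw [map_add, map_smul, hB.symm y e, hey, zero_add, smul_eq_mul] at hnonneg
  nlinarith

end PastCone

end IsLorentzForm

/-! ### Closed convex cones -/

section Cones

variable {E : Type*} [AddCommGroup E] [Module ℝ E] {X : Set E} {x : E}

theorem nonneg_of_mem_hull {f : Module.Dual ℝ E} (hf : ∀ z ∈ X, 0 ≤ f z)
    (hx : x ∈ PointedCone.hull ℝ X) : 0 ≤ f x :=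
  (Submodule.span_le (p := (PointedCone.positive ℝ ℝ).comap f)).2 (fun z hz => by
    simpa using hf z hz) hx

theorem map_mem_hull {L : E →ₗ[ℝ] E} (hL : ∀ z ∈ X, L z ∈ X) (hx : x ∈ PointedCone.hull ℝ X) :
    L x ∈ PointedCone.hull ℝ X :=
  (Submodule.span_le (p := (PointedCone.hull ℝ X).comap L)).2
    (fun z hz => PointedCone.subset_hull (hL z hz)) hx

section Closure

variable [TopologicalSpace E] [IsTopologicalAddGroup E] [ContinuousSMul ℝ E]

theorem subset_closure_hull : X ⊆ ((PointedCone.hull ℝ X).closure : Set E) := fun _ hx =>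
  subset_closure (PointedCone.subset_hull hx)

theorem closure_hull_le {T : PointedCone ℝ E} (hT : IsClosed (T : Set E)) (hX : X ⊆ T) :
    (PointedCone.hull ℝ X).closure ≤ T := fun _ hx =>
  closure_minimal (s := (PointedCone.hull ℝ X : Set E)) (t := (T : Set E))
    (Submodule.span_le.2 hX) hT hx

theorem nonneg_of_mem_closure_hull {f : Module.Dual ℝ E} (hf : Continuous f)
    (hX : ∀ z ∈ X, 0 ≤ f z) (hx : x ∈ (PointedCone.hull ℝ X).closure) : 0 ≤ f x :=
  closure_minimal (s := (PointedCone.hull ℝ X : Set E)) (t := {z | 0 ≤ f z})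
    (fun _ hz => nonneg_of_mem_hull hX hz) (isClosed_le continuous_const hf) hx

theorem map_mem_closure_hull {L : E →ₗ[ℝ] E} (hL : Continuous L) (hX : ∀ z ∈ X, L z ∈ X)
    (hx : x ∈ (PointedCone.hull ℝ X).closure) : L x ∈ (PointedCone.hull ℝ X).closure :=
  map_mem_closure hL hx fun _ hz => map_mem_hull hX hz

end Closure

/-- The sum of a basis contained in `X` is such a point. -/
theorem exists_mem_hull_forall_pos [FiniteDimensional ℝ E] (hX : Submodule.span ℝ X = ⊤) :
    ∃ x ∈ PointedCone.hull ℝ X, ∀ f : Module.Dual ℝ E, (∀ z ∈ X, 0 ≤ f z) → f ≠ 0 → 0 < f x := by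
  let b := Module.Basis.ofSpan hX.ge
  have hb : ∀ i, b i ∈ X := fun i => Module.Basis.ofSpan_subset hX.ge (Set.mem_range_self i)
  have := FiniteDimensional.fintypeBasisIndex b
  refine ⟨∑ i, b i, sum_mem fun i _ => PointedCone.subset_hull (hb i), fun f hf hf0 => ?_⟩
  rw [map_sum]
  refine (Finset.sum_nonneg fun i _ => hf _ (hb i)).lt_of_ne' fun hsum => hf0 ?_
  refine b.ext fun i => ?_
  simpa using (Finset.sum_eq_zero_iff_of_nonneg fun i _ => hf _ (hb i)).1 hsum i (Finset.mem_univ i)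

end Cones

section Coercivity

variable {E : Type*} [NormedAddCommGroup E] [NormedSpace ℝ E] [FiniteDimensional ℝ E] {X : Set E}
  {f : Module.Dual ℝ E}

theorem exists_pos_forall_mul_norm_le (hX : IsClosed X)
    (hsmul : ∀ c : ℝ, 0 ≤ c → ∀ x ∈ X, c • x ∈ X) (hf : ∀ x ∈ X, x ≠ 0 → 0 < f x) :
    ∃ δ : ℝ, 0 < δ ∧ ∀ x ∈ X, δ * ‖x‖ ≤ f x := by
  have hcompact : IsCompact (X ∩ Metric.sphere (0 : E) 1) := (isCompact_sphere _ _).inter_left hX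
  obtain ⟨δ, hδ, hle⟩ := hcompact.exists_forall_le' (a := 0)
    (f.continuous_of_finiteDimensional.continuousOn) fun x hx =>
      hf x hx.1 (ne_zero_of_mem_unit_sphere ⟨x, hx.2⟩)
  refine ⟨δ, hδ, fun x hx => ?_⟩
  rcases eq_or_ne x 0 with rfl | hx0
  · simp
  have hnorm : 0 < ‖x‖ := norm_pos_iff.2 hx0
  have hunit : δ ≤ f (‖x‖⁻¹ • x) := hle _ ⟨hsmul _ (by positivity) x hx, by
    simp [norm_smul, hnorm.ne']⟩
  rwa [map_smul, smul_eq_mul, inv_mul_eq_div, le_div_iff₀ hnorm] at hunit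

theorem exists_isMinOn_level (hX : IsClosed X) (hsmul : ∀ c : ℝ, 0 ≤ c → ∀ x ∈ X, c • x ∈ X)
    (hf : ∀ x ∈ X, x ≠ 0 → 0 < f x) {q : E → ℝ} (hq : Continuous q) {z : E} (hz : z ∈ X) :
    ∃ y ∈ X, q y = q z ∧ IsMinOn f {x ∈ X | q x = q z} y := by
  obtain ⟨δ, hδ, hcoercive⟩ := exists_pos_forall_mul_norm_le hX hsmul hf
  have hclosed : IsClosed {x ∈ X | q x = q z} := hX.inter (isClosed_eq hq continuous_const)
  obtain ⟨y, ⟨hy, hqy⟩, hmin⟩ :=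
    f.continuous_of_finiteDimensional.continuousOn.exists_isMinOn' hclosed (x₀ := z) ⟨hz, rfl⟩ (by
      filter_upwards [((tendsto_norm_cocompact_atTop (E := E)).eventually_ge_atTop
        (f z / δ)).filter_mono inf_le_left, Filter.mem_inf_of_right (Filter.mem_principal_self _)]
        with x hx hxX
      exact ((div_le_iff₀' hδ).1 hx).trans (hcoercive x hxX.1))
  exact ⟨y, hy, hqy, hmin⟩

end Coercivity

theorem exists_pos_forall_add_mul_pos {ι : Type*} [Finite ι] {a : ι → ℝ} (ha : ∀ i, 0 < a i)
    (b : ι → ℝ) : ∃ ε : ℝ, 0 < ε ∧ ∀ i, 0 < a i + ε * b i := by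
  have hnear : ∀ᶠ ε in nhds (0 : ℝ), ∀ i, 0 < a i + ε * b i := by
    refine Filter.eventually_all.2 fun i => ?_
    have hcont : Continuous fun t : ℝ => a i + t * b i := by fun_prop
    exact (hcont.tendsto 0).eventually_const_lt (by simpa using ha i)
  obtain ⟨ε, hpos, hε⟩ := ((hnear.filter_mono (nhdsWithin_le_nhds (s := Set.Ioi 0))).and
    self_mem_nhdsWithin).exists
  exact ⟨ε, hε, hpos⟩

/-! ### Polytopes whose edges are tangent to the light cone -/

section Edges

variable {E : Type*} [AddCommGroup E] [Module ℝ E] {T F : PointedCone ℝ E}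

theorem IsProjEdge.exists_forall_ne_smul (hF : IsProjEdge T F) (y : E) :
    ∃ x ∈ F, ∀ c : ℝ, x ≠ c • y := by
  by_contra! hline
  have hle : Submodule.span ℝ (F : Set E) ≤ Submodule.span ℝ {y} :=
    Submodule.span_le.2 fun x hx =>
      Submodule.mem_span_singleton.2 ((hline x hx).imp fun _ => Eq.symm)
  have hrank := (Submodule.finrank_mono hle).trans (finrank_span_le_card ({y} : Set E))
  rw [hF.2, Set.toFinset_singleton, Finset.card_singleton] at hrank
  omega

theorem isFaceOf_inf_ker {f : Module.Dual ℝ E} (hf : ∀ z ∈ T, 0 ≤ f z) :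
    (T ⊓ PointedCone.ofSubmodule (LinearMap.ker f)).IsFaceOf T := by
  refine ⟨inf_le_left, fun {x y a} hx hy ha hxy => ⟨hx, ?_⟩⟩
  have hsum : a * f x + f y = 0 := by simpa using hxy.2
  have hx0 := hf x hx
  have : a * f x ≤ 0 := by linarith [hf y hy]
  exact le_antisymm (nonpos_of_mul_nonpos_right this ha) hx0

theorem projSet_span_pair_inter_lightlike {B : LinearMap.BilinForm ℝ E} (hB : B.IsSymm) {x y : E}
    (hx : B x x ≠ 0) (hy : B y y = 0) (hyx : B y x = 0) (hy0 : y ≠ 0) :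
    projSet (Submodule.span ℝ {x, y} : Set E) ∩ projSet {z | B z z = 0} =
      {Projectivization.mk ℝ y hy0} := by
  refine Set.eq_singleton_iff_unique_mem.2
    ⟨⟨⟨y, Submodule.subset_span (by simp), hy0, rfl⟩, ⟨y, hy, hy0, rfl⟩⟩, ?_⟩
  rintro _ ⟨⟨z, hz, hz0, rfl⟩, ⟨z', hz', hz'0, hzz'⟩⟩
  obtain ⟨k, rfl⟩ := (Projectivization.mk_eq_mk_iff' ℝ _ _ hz0 hz'0).1 hzz'.symm
  obtain ⟨a, c, hac⟩ := Submodule.mem_span_pair.1 hz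
  have hxy : B x y = 0 := by rw [← hyx]; exact hB.eq x y
  have hself : B (a • x + c • y) (a • x + c • y) = 0 := by
    have : B z' z' = 0 := hz'
    simp [hac, this]
  have ha : a = 0 := by simpa [hy, hyx, hxy, hx] using hself
  exact (Projectivization.mk_eq_mk_iff' ℝ _ _ _ hy0).2 ⟨c, by simp [← hac, ha]⟩

end Edges

/-- The cap of the projective light cone cut out by the half-space `0 ≤ B ω x`, where a light-like
line is represented by a past vector `x`. -/
def cap {E : Type*} [AddCommGroup E] [Module ℝ E] (B : LinearMap.BilinForm ℝ E) (v ω : E) :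
    Set (ℙ ℝ E) :=
  projSet {x | x ∈ pastCone B v ∧ B x x = 0 ∧ 0 ≤ B ω x}

/-- A closed convex cone `T` generated by space-like vectors `Ω`, lying on the past side of a
time-like vector `v` and containing the past cone, such that the orthogonal projection of `T` along
every `ω ∈ Ω` stays in the past cone: the part of `T` seen from `ω` is no wider than the cone of
rays from `ω` tangent to the light cone. -/
structure IsLorentzPolytope {E : Type*} [AddCommGroup E] [Module ℝ E] [TopologicalSpace E]
    [IsTopologicalAddGroup E] [ContinuousSMul ℝ E] (B : LinearMap.BilinForm ℝ E) (v : E)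
    (Ω : Set E) (T : PointedCone ℝ E) : Prop where
  isLorentzForm : IsLorentzForm B
  form_self_neg : B v v < 0
  form_self_pos : ∀ ω ∈ Ω, 0 < B ω ω
  eq_closure_hull : T = (PointedCone.hull ℝ Ω).closure
  pastCone_subset : pastCone B v ⊆ T
  form_pos : ∀ x ∈ T, x ≠ 0 → 0 < B x v
  orthProj_mem : ∀ ω ∈ Ω, ∀ x ∈ T, orthProj B ω x ∈ pastCone B v

namespace IsLorentzForm

variable {E : Type*} [AddCommGroup E] [Module ℝ E] {B : LinearMap.BilinForm ℝ E} {v x ω : E}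

theorem mem_span_singleton_of_forall_pastCone (hB : IsLorentzForm B) (hv : B v v < 0)
    (hω : 0 < B ω ω) (hx : ∀ ξ ∈ pastCone B v, B ξ ω = 0 → B ξ x = 0) :
    x ∈ Submodule.span ℝ {ω} := by
  obtain ⟨e, he, heω, hee⟩ := hB.exists_mem_pastCone_orthogonal hv hω
  set u := orthProj B ω x
  have huω : B u ω = 0 := form_orthProj hω.ne' x
  have hxu : ∀ ξ ∈ pastCone B v, B ξ ω = 0 → B ξ u = 0 := fun ξ hξ hξω => by
    rw [← form_eq_form_orthProj hξω x]
    exact hx ξ hξ hξω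
  obtain ⟨ε, hε, hmem, -⟩ := hB.exists_add_smul_mem_pastCone hv he hee u
  have huu : B u u = 0 := by
    simpa [hxu e he heω, hε.ne'] using hxu _ hmem (by simp [heω, huω])
  have hu : u = 0 := hB.eq_zero_of_orthogonal hee (hxu e he heω) huu.le
  exact Submodule.mem_span_singleton.2
    ⟨_, by simpa [u, hu] using (eq_smul_add_orthProj B ω x).symm⟩

theorem mk_mem_cap_iff (hB : IsLorentzForm B) (hv : B v v < 0) (hx : x ∈ pastCone B v)
    (hx0 : x ≠ 0) : Projectivization.mk ℝ x hx0 ∈ cap B v ω ↔ B x x = 0 ∧ 0 ≤ B ω x := by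
  refine ⟨?_, fun h => ⟨x, ⟨hx, h⟩, hx0, rfl⟩⟩
  rintro ⟨y, ⟨hy, hyy, hωy⟩, hy0, hyx⟩
  obtain ⟨c, rfl⟩ := (Projectivization.mk_eq_mk_iff' ℝ _ _ hy0 hx0).1 hyx
  have hcx := hB.form_pos_of_mem_pastCone hv hy hy0
  rw [map_smul, LinearMap.smul_apply, smul_eq_mul] at hcx
  have hc : 0 < c := pos_of_mul_pos_left hcx hx.2
  simp only [map_smul, LinearMap.smul_apply, smul_eq_mul] at hyy hωy
  exact ⟨by simpa [hc.ne'] using hyy, nonneg_of_mul_nonneg_right hωy hc⟩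

theorem cap_smul {c : ℝ} (hc : 0 < c) (v ω : E) : cap B v (c • ω) = cap B v ω := by
  simp [cap, mul_nonneg_iff_of_pos_left hc]

theorem cap_nontrivial [FiniteDimensional ℝ E] (hB : IsLorentzForm B) (hv : B v v < 0)
    (hE : 3 ≤ Module.finrank ℝ E) (hω : 0 < B ω ω) : (cap B v ω).Nontrivial := by
  obtain ⟨e, he, heω, hee⟩ := hB.exists_mem_pastCone_orthogonal hv hω
  obtain ⟨u, hu0, heu, hωu⟩ := exists_ne_zero_of_two_functionals hE (B e) (B ω)
  obtain ⟨t, ht, hadd, hsub⟩ := hB.exists_lightlike hee hu0 heu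
  have hωe : B ω e = 0 := by rw [hB.symm, heω]
  have hform : ∀ c : ℝ, B (e + c • u) e = B e e := fun c => by simp [hB.symm u e, heu]
  have hne : ∀ c : ℝ, e + c • u ≠ 0 := fun c h => hee.ne (by rw [← hform c, h]; simp)
  have hmem : ∀ c : ℝ, B (e + c • u) (e + c • u) = 0 →
      Projectivization.mk ℝ (e + c • u) (hne c) ∈ cap B v ω := fun c hc =>
    ⟨_, ⟨hB.mem_pastCone_of_form_nonneg hv (u := -e) hc.le (by simpa using hee)
      (by simpa using he.2) (by rw [map_neg, hform]; linarith), hc, by simp [hωe, hωu]⟩, _, rfl⟩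
  refine ⟨_, hmem t hadd, _, hmem (-t) hsub, fun heq => ?_⟩
  obtain ⟨k, hk⟩ := (Projectivization.mk_eq_mk_iff' ℝ _ _ _ _).1 heq
  have hk1 : k = 1 := by simpa [heu, hee.ne] using congrArg (B e) hk
  rw [hk1, one_smul, add_right_inj] at hk
  exact ht.ne (by linarith [smul_left_injective ℝ hu0 hk])

end IsLorentzForm

namespace IsLorentzPolytope

variable {E : Type*} [AddCommGroup E] [Module ℝ E] [TopologicalSpace E] [IsTopologicalAddGroup E]
  [ContinuousSMul ℝ E] {B : LinearMap.BilinForm ℝ E} {v : E} {Ω : Set E} {T F : PointedCone ℝ E}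
  {x y ω ω' : E}

theorem subset (h : IsLorentzPolytope B v Ω T) : Ω ⊆ T := by
  rw [h.eq_closure_hull]
  exact subset_closure_hull

theorem ne_zero (h : IsLorentzPolytope B v Ω T) (hω : ω ∈ Ω) : ω ≠ 0 := by
  rintro rfl
  simpa using h.form_self_pos _ hω

theorem pos_of_smul_mem (h : IsLorentzPolytope B v Ω T) (hx : x ∈ T) {c : ℝ} (hcx : c • x ∈ T)
    (hcx0 : c • x ≠ 0) : 0 < c := by
  have hpos := h.form_pos _ hcx hcx0
  rw [map_smul, LinearMap.smul_apply, smul_eq_mul] at hpos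
  exact pos_of_mul_pos_left hpos (h.form_pos _ hx (right_ne_zero_of_smul hcx0)).le

theorem mem_of_mk_mem_projSet (h : IsLorentzPolytope B v Ω T) (hF : F ≤ T) (hx : x ∈ T)
    (hx0 : x ≠ 0) (hxF : Projectivization.mk ℝ x hx0 ∈ projSet (F : Set E)) : x ∈ F := by
  obtain ⟨y, hy, hy0, hyx⟩ := hxF
  obtain ⟨c, rfl⟩ := (Projectivization.mk_eq_mk_iff' ℝ _ _ hx0 hy0).1 hyx.symm
  exact PointedCone.smul_mem _ (h.pos_of_smul_mem (hF hy) hx hx0).le hy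

theorem mem_pastCone_of_form_nonpos (h : IsLorentzPolytope B v Ω T) (hx : x ∈ T)
    (hxx : B x x ≤ 0) : x ∈ pastCone B v := by
  refine ⟨hxx, ?_⟩
  rcases eq_or_ne x 0 with rfl | hx0
  · simp
  · exact (h.form_pos x hx hx0).le

theorem form_neg_of_forall_ne_smul (h : IsLorentzPolytope B v Ω T) (hω : ω ∈ Ω) (hω' : ω' ∈ Ω)
    (hne : ∀ c : ℝ, ω' ≠ c • ω) : B ω' ω < 0 := by
  have hB := h.isLorentzForm
  by_contra! hnonneg
  have hπ := h.orthProj_mem _ hω _ (h.subset hω')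
  have hπ' := h.orthProj_mem _ hω' _ (h.subset hω)
  set a := B ω' ω / B ω ω with ha_def
  set a' := B ω ω' / B ω' ω' with ha'_def
  have ha : 0 ≤ a := div_nonneg hnonneg (h.form_self_pos _ hω).le
  have hmem := hB.add_mem_pastCone h.form_self_neg hπ (IsLorentzForm.smul_mem_pastCone ha hπ')
  have hsum : orthProj B ω ω' + a • orthProj B ω' ω = (1 - a * a') • ω' := by
    rw [orthProj_apply, orthProj_apply, ← ha_def, ← ha'_def]
    module
  have hzero : orthProj B ω ω' + a • orthProj B ω' ω = 0 := by
    by_contra hne0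
    rw [hsum] at hmem hne0
    refine hmem.1.not_gt ?_
    simpa [← mul_assoc] using mul_pos (mul_self_pos.2 (left_ne_zero_of_smul hne0))
      (h.form_self_pos _ hω')
  have hπv := hB.form_pos_of_mem_pastCone h.form_self_neg hπ (orthProj_ne_zero hne)
  have hv0 : B (orthProj B ω ω') v + a * B (orthProj B ω' ω) v = 0 := by
    simpa using congrArg (fun z => B z v) hzero
  linarith [mul_nonneg ha hπ'.2]

theorem form_nonpos_of_orthogonal (h : IsLorentzPolytope B v Ω T) (hω : ω ∈ Ω)
    (hy : y ∈ pastCone B v) (hyω : B y ω = 0) (hx : x ∈ T) : B y x ≤ 0 := by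
  rw [form_eq_form_orthProj hyω x]
  exact h.isLorentzForm.form_nonpos_of_mem_pastCone h.form_self_neg hy (h.orthProj_mem _ hω _ hx)

theorem exists_form_pos [T2Space E] [FiniteDimensional ℝ E] (h : IsLorentzPolytope B v Ω T)
    (hx : x ∈ T) (hxx : 0 < B x x) : ∃ ω ∈ Ω, 0 < B x ω := by
  by_contra! hle
  rw [h.eq_closure_hull] at hx
  have hneg := nonneg_of_mem_closure_hull (f := -B x) (LinearMap.continuous_of_finiteDimensional _)
    (fun ω hω => by simpa using hle ω hω) hx
  rw [LinearMap.neg_apply] at hneg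
  linarith

section Vertices

theorem mk_mem_projVertices (h : IsLorentzPolytope B v Ω T) (hω : ω ∈ Ω) (hω0 : ω ≠ 0) :
    Projectivization.mk ℝ ω hω0 ∈ projVertices T := by
  refine ⟨⟨ω, h.subset hω, hω0, rfl⟩, fun y hy => ?_⟩
  rw [Projectivization.submodule_mk] at hy ⊢
  refine h.isLorentzForm.mem_span_singleton_of_forall_pastCone h.form_self_neg
    (h.form_self_pos _ hω) fun ξ hξ hξω => ?_
  have hsupport := hy (-B ξ)
    (fun z hz => by simpa using h.form_nonpos_of_orthogonal hω hξ hξω hz) fun x hx => by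
      obtain ⟨c, rfl⟩ := Submodule.mem_span_singleton.1 hx
      simp [hξω]
  simpa using hsupport

/-- A causal vertex would be supported only by its own tangent hyperplane, by self-duality of the
past cone. -/
theorem form_self_pos_of_mk_mem_projVertices [FiniteDimensional ℝ E]
    (h : IsLorentzPolytope B v Ω T) (hE : 3 ≤ Module.finrank ℝ E) (hx : x ∈ T) (hx0 : x ≠ 0)
    (hvert : Projectivization.mk ℝ x hx0 ∈ projVertices T) : 0 < B x x := by
  have hB := h.isLorentzForm
  by_contra! hxx
  have hxp := h.mem_pastCone_of_form_nonpos hx hxx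
  obtain ⟨u, hu0, hxu, hvu⟩ := exists_ne_zero_of_two_functionals hE (B x) (B v)
  have hmem := hvert.2 u fun f hf hfx => by
    obtain ⟨y, hy⟩ := hB.exists_form_eq f
    have hyp := hB.neg_mem_pastCone_of_forall_nonneg h.form_self_neg (y := y) fun z hz => by
      rw [hy]; exact hf z (h.pastCone_subset hz)
    have hxy : B x (-y) = 0 := by
      rw [map_neg, hB.symm, hy, hfx x (by simp [Submodule.mem_span_singleton_self]), neg_zero]
    obtain ⟨c, hc⟩ := hB.exists_eq_smul_of_mem_pastCone h.form_self_neg hxp hyp hx0 hxy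
    rw [← hy, neg_eq_iff_eq_neg.1 hc]
    simp [hxu]
  obtain ⟨c, rfl⟩ := Submodule.mem_span_singleton.1 (by simpa using hmem)
  rw [map_smul, smul_eq_mul, hB.symm] at hvu
  rw [(mul_eq_zero.1 hvu).resolve_right (h.form_pos x hx hx0).ne', zero_smul] at hu0
  exact hu0 rfl

theorem apply_eq_zero_of_form_pos (h : IsLorentzPolytope B v Ω T) {f : Module.Dual ℝ E}
    (hf : ∀ z ∈ T, 0 ≤ f z) (hx : x ∈ T) (hfx : f x = 0) (hω : ω ∈ Ω) (hxω : 0 < B x ω) :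
    f ω = 0 := by
  have ha := div_pos hxω (h.form_self_pos _ hω)
  rw [eq_smul_add_orthProj B ω x, map_add, map_smul, smul_eq_mul] at hfx
  have hfω := hf ω (h.subset hω)
  have hfπ := hf _ (h.pastCone_subset (h.orthProj_mem _ hω _ hx))
  exact (nonpos_of_mul_nonpos_right (by linarith) ha).antisymm hfω

theorem projVertices_eq [T2Space E] [FiniteDimensional ℝ E] (h : IsLorentzPolytope B v Ω T)
    (hE : 3 ≤ Module.finrank ℝ E) : projVertices T = projSet Ω := by
  refine Set.Subset.antisymm ?_ ?_
  · rintro _ ⟨⟨x, hx, hx0, rfl⟩, hvert⟩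
    have hxx := h.form_self_pos_of_mk_mem_projVertices hE hx hx0 ⟨⟨x, hx, hx0, rfl⟩, hvert⟩
    obtain ⟨ω, hω, hxω⟩ := h.exists_form_pos hx hxx
    rw [Projectivization.submodule_mk] at hvert
    obtain ⟨c, hc⟩ := Submodule.mem_span_singleton.1 (hvert ω fun f hf hfx =>
      h.apply_eq_zero_of_form_pos hf hx (hfx x (Submodule.mem_span_singleton_self x)) hω hxω)
    exact ⟨ω, hω, h.ne_zero hω, (Projectivization.mk_eq_mk_iff' ℝ _ _ _ hx0).2 ⟨c, hc⟩⟩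
  · rintro _ ⟨ω, hω, hω0, rfl⟩
    exact h.mk_mem_projVertices hω hω0

theorem eq_closure_hull_vertices (h : IsLorentzPolytope B v Ω T) :
    T = (PointedCone.hull ℝ {x | ∃ hx : x ≠ 0, x ∈ T ∧
      Projectivization.mk ℝ x hx ∈ projVertices T}).closure := by
  have hclosed : IsClosed (T : Set E) := by
    rw [h.eq_closure_hull]
    exact isClosed_closure
  refine le_antisymm ?_ (closure_hull_le hclosed fun x ⟨_, hx, _⟩ => hx)
  exact h.eq_closure_hull.le.trans <| closure_hull_le isClosed_closure fun ω hω =>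
    subset_closure_hull ⟨h.ne_zero hω, h.subset hω, h.mk_mem_projVertices hω _⟩

end Vertices

section EdgeTangency

theorem span_eq_top_of_mem_face (h : IsLorentzPolytope B v Ω T) (hF : F.IsFaceOf T) (hxF : x ∈ F)
    (hx : x ∈ pastCone B v) (hxx : B x x < 0) : Submodule.span ℝ (F : Set E) = ⊤ := by
  refine eq_top_iff.2 fun z _ => ?_
  obtain ⟨ε, hε, hadd, hsub⟩ :=
    h.isLorentzForm.exists_add_smul_mem_pastCone h.form_self_neg hx hxx z
  have hmem : x + ε • z ∈ F := by
    refine hF.mem_of_add_mem_left (h.pastCone_subset hadd) (h.pastCone_subset hsub) ?_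
    convert add_mem hxF hxF using 1
    module
  have hz : z = ε⁻¹ • ((x + ε • z) - x) := by
    rw [add_sub_cancel_left, inv_smul_smul₀ hε.ne']
  rw [hz]
  exact Submodule.smul_mem _ _ (Submodule.sub_mem _ (Submodule.subset_span hmem)
    (Submodule.subset_span hxF))

theorem form_self_eq_zero_of_mem_edge (h : IsLorentzPolytope B v Ω T)
    (hE : 3 ≤ Module.finrank ℝ E) (hF : IsProjEdge T F) (hxF : x ∈ F) (hxx : B x x ≤ 0) :
    B x x = 0 := by
  by_contra hne
  have hx := h.mem_pastCone_of_form_nonpos (hF.1.le hxF) hxx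
  have hrank := hF.2
  rw [h.span_eq_top_of_mem_face hF.1 hxF hx (hxx.lt_of_ne hne), finrank_top] at hrank
  omega

theorem exists_form_self_pos_of_edge (h : IsLorentzPolytope B v Ω T)
    (hE : 3 ≤ Module.finrank ℝ E) (hF : IsProjEdge T F) : ∃ x ∈ F, 0 < B x x := by
  have hB := h.isLorentzForm
  by_contra! hcausal
  have hpast : ∀ x ∈ F, x ∈ pastCone B v := fun x hx =>
    h.mem_pastCone_of_form_nonpos (hF.1.le hx) (hcausal x hx)
  obtain ⟨x, hx, hx0⟩ := hF.exists_forall_ne_smul 0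
  obtain ⟨y, hy, hyx⟩ := hF.exists_forall_ne_smul x
  have hself : ∀ z ∈ F, B z z = 0 := fun z hz =>
    h.form_self_eq_zero_of_mem_edge hE hF hz (hcausal z hz)
  have hxy : B x y = 0 := by
    have hadd := form_add_self hB.isSymm x y
    rw [hself _ (add_mem hx hy), hself x hx, hself y hy] at hadd
    linarith
  obtain ⟨c, hc⟩ := hB.exists_eq_smul_of_mem_pastCone h.form_self_neg (hpast x hx) (hpast y hy)
    (by simpa using hx0) hxy
  exact hyx c hc

theorem mem_face_of_form_pos (h : IsLorentzPolytope B v Ω T) (hF : F.IsFaceOf T) (hx : x ∈ F)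
    (hω : ω ∈ Ω) (hxω : 0 < B x ω) : ω ∈ F := by
  refine hF.mem_of_smul_add_mem (h.subset hω)
    (h.pastCone_subset (h.orthProj_mem _ hω _ (hF.le hx))) (div_pos hxω (h.form_self_pos _ hω)) ?_
  rwa [← eq_smul_add_orthProj]

theorem orthProj_mem_face (h : IsLorentzPolytope B v Ω T) (hF : F.IsFaceOf T) (hω : ω ∈ Ω)
    (hωF : ω ∈ F) (hx : x ∈ F) : orthProj B ω x ∈ F := by
  rcases le_total 0 (B x ω / B ω ω) with ha | ha
  · refine hF.mem_of_add_mem_right (PointedCone.smul_mem _ ha (h.subset hω))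
      (h.pastCone_subset (h.orthProj_mem _ hω _ (hF.le hx))) ?_
    rwa [← eq_smul_add_orthProj]
  · rw [orthProj_apply, sub_eq_add_neg, ← neg_smul]
    exact add_mem hx (PointedCone.smul_mem _ (neg_nonneg.2 ha) hωF)

theorem exists_edge_generators [T2Space E] [FiniteDimensional ℝ E] (h : IsLorentzPolytope B v Ω T)
    (hE : 3 ≤ Module.finrank ℝ E) (hF : IsProjEdge T F) :
    ∃ ω ∈ Ω, ∃ y ∈ F, y ≠ 0 ∧ B y ω = 0 ∧ B y y = 0 ∧
      Submodule.span ℝ (F : Set E) = Submodule.span ℝ {ω, y} := by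
  obtain ⟨x, hxF, hxx⟩ := h.exists_form_self_pos_of_edge hE hF
  obtain ⟨ω, hω, hxω⟩ := h.exists_form_pos (hF.1.le hxF) hxx
  have hωω := (h.form_self_pos _ hω).ne'
  have hωF := h.mem_face_of_form_pos hF.1 hxF hω hxω
  obtain ⟨z, hz, hzω⟩ := hF.exists_forall_ne_smul ω
  have hπF := h.orthProj_mem_face hF.1 hω hωF hz
  have hπ0 := orthProj_ne_zero (B := B) hzω
  have hπω := form_orthProj hωω z
  have hππ := h.form_self_eq_zero_of_mem_edge hE hF hπF (h.orthProj_mem _ hω _ (hF.1.le hz)).1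
  refine ⟨ω, hω, _, hπF, hπ0, hπω, hππ, (Submodule.eq_of_le_of_finrank_eq
    (Submodule.span_mono ?_) ?_).symm⟩
  · rintro _ (rfl | rfl) <;> assumption
  · rw [hF.2, finrank_span_pair_of_orthogonal hωω hπ0 hπω]

theorem edge_tangent [T2Space E] [FiniteDimensional ℝ E] (h : IsLorentzPolytope B v Ω T)
    (hE : 3 ≤ Module.finrank ℝ E) (hF : IsProjEdge T F) :
    ∃ p ∈ projSet (F : Set E),
      projSet (Submodule.span ℝ (F : Set E) : Set E) ∩ projSet {x | B x x = 0} = {p} := by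
  obtain ⟨ω, hω, y, hyF, hy0, hyω, hyy, hspan⟩ := h.exists_edge_generators hE hF
  refine ⟨_, ⟨y, hyF, hy0, rfl⟩, ?_⟩
  rw [hspan]
  exact projSet_span_pair_inter_lightlike h.isLorentzForm.isSymm (h.form_self_pos _ hω).ne' hyy
    hyω hy0

end EdgeTangency

section Tangency

theorem eq_mk_orthProj_of_mem_cap_inter (h : IsLorentzPolytope B v Ω T) (hω : ω ∈ Ω)
    (hω' : ω' ∈ Ω) (hne : ∀ c : ℝ, ω' ≠ c • ω) {p : ℙ ℝ E} (hp : p ∈ cap B v ω ∩ cap B v ω') :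
    B (orthProj B ω ω') (orthProj B ω ω') = 0 ∧
      p = Projectivization.mk ℝ (orthProj B ω ω') (orthProj_ne_zero hne) := by
  have hB := h.isLorentzForm
  obtain ⟨⟨x, ⟨hx, hxx, hωx⟩, hx0, rfl⟩, hp'⟩ := hp
  have hω'x := ((hB.mk_mem_cap_iff h.form_self_neg hx hx0).1 hp').2
  have hπ := h.orthProj_mem _ hω _ (h.subset hω')
  have ha := div_neg_of_neg_of_pos (h.form_neg_of_forall_ne_smul hω hω' hne) (h.form_self_pos _ hω)
  have hxπ : B x (orthProj B ω ω') = 0 := by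
    refine (hB.form_nonpos_of_mem_pastCone h.form_self_neg hx hπ).antisymm ?_
    have hsplit : B x ω' = B ω' ω / B ω ω * B x ω + B x (orthProj B ω ω') := by
      simpa using congrArg (B x) (eq_smul_add_orthProj B ω ω')
    rw [hB.symm] at hω'x hωx
    nlinarith
  obtain ⟨c, hc⟩ := hB.exists_eq_smul_of_mem_pastCone h.form_self_neg hx hπ hx0 hxπ
  exact ⟨by simp [hc, hxx], ((Projectivization.mk_eq_mk_iff' ℝ _ _ _ hx0).2 ⟨c, hc.symm⟩).symm⟩

theorem mk_orthProj_mem_cap_inter (h : IsLorentzPolytope B v Ω T) (hω : ω ∈ Ω) (hω' : ω' ∈ Ω)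
    (hne : ∀ c : ℝ, ω' ≠ c • ω) (hππ : B (orthProj B ω ω') (orthProj B ω ω') = 0) :
    Projectivization.mk ℝ (orthProj B ω ω') (orthProj_ne_zero hne) ∈ cap B v ω ∩ cap B v ω' := by
  have hB := h.isLorentzForm
  have hωω := (h.form_self_pos _ hω).ne'
  have hπ := h.orthProj_mem _ hω _ (h.subset hω')
  have hωπ : B ω (orthProj B ω ω') = 0 := by rw [hB.symm, form_orthProj hωω]
  have hω'π : B ω' (orthProj B ω ω') = 0 := by rw [hB.symm, ← form_orthProj_self hωω, hππ]
  exact ⟨⟨_, ⟨hπ, hππ, hωπ.ge⟩, _, rfl⟩, ⟨_, ⟨hπ, hππ, hω'π.ge⟩, _, rfl⟩⟩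

theorem exists_cap_inter_eq_singleton_iff (h : IsLorentzPolytope B v Ω T) (hω : ω ∈ Ω)
    (hω' : ω' ∈ Ω) (hne : ∀ c : ℝ, ω' ≠ c • ω) :
    (∃ p, cap B v ω ∩ cap B v ω' = {p}) ↔ B (orthProj B ω ω') (orthProj B ω ω') = 0 := by
  refine ⟨fun ⟨p, hp⟩ => (h.eq_mk_orthProj_of_mem_cap_inter hω hω' hne (p := p) (by simp [hp])).1,
    fun hππ => ⟨_, Set.eq_singleton_iff_unique_mem.2
      ⟨h.mk_orthProj_mem_cap_inter hω hω' hne hππ, fun q hq =>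
        (h.eq_mk_orthProj_of_mem_cap_inter hω hω' hne hq).2⟩⟩⟩

theorem cap_eq_cap_iff [FiniteDimensional ℝ E] (h : IsLorentzPolytope B v Ω T)
    (hE : 3 ≤ Module.finrank ℝ E) (hω : ω ∈ Ω) (hω' : ω' ∈ Ω) :
    cap B v ω' = cap B v ω ↔ ∃ c : ℝ, ω' = c • ω := by
  constructor
  · intro heq
    by_contra! hne
    obtain ⟨p, hp, q, hq, hpq⟩ :=
      h.isLorentzForm.cap_nontrivial h.form_self_neg hE (h.form_self_pos _ hω)
    have hpoint := fun {r} (hr : r ∈ cap B v ω) =>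
      (h.eq_mk_orthProj_of_mem_cap_inter hω hω' hne ⟨hr, heq ▸ hr⟩).2
    exact hpq ((hpoint hp).trans (hpoint hq).symm)
  · rintro ⟨c, rfl⟩
    exact IsLorentzForm.cap_smul (h.pos_of_smul_mem (h.subset hω) (h.subset hω') (h.ne_zero hω'))
      v ω

/-- The hyperplane orthogonal to `y` is tangent to the light cone along `y`. -/
theorem isProjEdge_inf_ker (h : IsLorentzPolytope B v Ω T) (hω : ω ∈ Ω) (hy : y ∈ pastCone B v)
    (hy0 : y ≠ 0) (hyω : B y ω = 0) (hyy : B y y = 0) :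
    IsProjEdge T (T ⊓ PointedCone.ofSubmodule (LinearMap.ker (-B y))) := by
  refine ⟨isFaceOf_inf_ker fun z hz => by
    simpa using h.form_nonpos_of_orthogonal hω hy hyω hz, ?_⟩
  suffices hspan : Submodule.span ℝ ((T ⊓ PointedCone.ofSubmodule (LinearMap.ker (-B y)) :
      PointedCone ℝ E) : Set E) = Submodule.span ℝ {ω, y} by
    rw [hspan, finrank_span_pair_of_orthogonal (h.form_self_pos _ hω).ne' hy0 hyω]
  refine le_antisymm (Submodule.span_le.2 fun z ⟨hzT, hyz⟩ => ?_) (Submodule.span_mono ?_)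
  · have hyπ : B y (orthProj B ω z) = 0 := by
      rw [← form_eq_form_orthProj hyω]
      simpa using hyz
    obtain ⟨c, hc⟩ := h.isLorentzForm.exists_eq_smul_of_mem_pastCone h.form_self_neg hy
      (h.orthProj_mem _ hω _ hzT) hy0 hyπ
    exact Submodule.mem_span_pair.2 ⟨_, c, by rw [← hc]; exact (eq_smul_add_orthProj B ω z).symm⟩
  · rintro z (rfl | rfl)
    · exact ⟨h.subset hω, by simpa using hyω⟩
    · exact ⟨h.pastCone_subset hy, by simpa using hyy⟩

theorem exists_edge_iff (h : IsLorentzPolytope B v Ω T) (hE : 3 ≤ Module.finrank ℝ E)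
    (hω : ω ∈ Ω) (hω' : ω' ∈ Ω) (hne : ∀ c : ℝ, ω' ≠ c • ω) (hω0 : ω ≠ 0) (hω'0 : ω' ≠ 0) :
    (∃ F : PointedCone ℝ E, IsProjEdge T F ∧ Projectivization.mk ℝ ω hω0 ∈ projSet (F : Set E) ∧
      Projectivization.mk ℝ ω' hω'0 ∈ projSet (F : Set E)) ↔
      B (orthProj B ω ω') (orthProj B ω ω') = 0 := by
  have hωω := (h.form_self_pos _ hω).ne'
  have hπ := h.orthProj_mem _ hω _ (h.subset hω')
  constructor
  · rintro ⟨F, hF, hωF, hω'F⟩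
    refine h.form_self_eq_zero_of_mem_edge hE hF (h.orthProj_mem_face hF.1 hω ?_ ?_) hπ.1
    · exact h.mem_of_mk_mem_projSet hF.1.le (h.subset hω) hω0 hωF
    · exact h.mem_of_mk_mem_projSet hF.1.le (h.subset hω') hω'0 hω'F
  · intro hππ
    refine ⟨_, h.isProjEdge_inf_ker hω hπ (orthProj_ne_zero hne) (form_orthProj hωω _) hππ,
      ⟨ω, ⟨h.subset hω, ?_⟩, hω0, rfl⟩, ⟨ω', ⟨h.subset hω', ?_⟩, hω'0, rfl⟩⟩
    · simpa using form_orthProj hωω ω'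
    · simpa [← form_orthProj_self hωω] using hππ

end Tangency

section Isomorphism

variable [T2Space E] [FiniteDimensional ℝ E]

theorem exists_equiv_projVertices (h : IsLorentzPolytope B v Ω T) (hE : 3 ≤ Module.finrank ℝ E) :
    ∃ φ : cap B v '' Ω ≃ projVertices T, ∀ (ω : E) (hω : ω ∈ Ω) (hω0 : ω ≠ 0),
      (φ ⟨cap B v ω, Set.mem_image_of_mem _ hω⟩ : ℙ ℝ E) = Projectivization.mk ℝ ω hω0 := by
  choose ρ hρ hρcap using fun b : cap B v '' Ω => b.2
  let φ : cap B v '' Ω → projVertices T := fun b =>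
    ⟨Projectivization.mk ℝ (ρ b) (h.ne_zero (hρ b)), h.mk_mem_projVertices (hρ b) _⟩
  have hφ : ∀ (ω : E) (hω : ω ∈ Ω) (hω0 : ω ≠ 0),
      (φ ⟨cap B v ω, Set.mem_image_of_mem _ hω⟩ : ℙ ℝ E) = Projectivization.mk ℝ ω hω0 :=
    fun ω hω hω0 => by
      obtain ⟨c, hc⟩ := (h.cap_eq_cap_iff hE hω (hρ _)).1 (hρcap ⟨_, Set.mem_image_of_mem _ hω⟩)
      exact (Projectivization.mk_eq_mk_iff' ℝ _ _ _ hω0).2 ⟨c, hc.symm⟩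
  have hinj : Function.Injective φ := fun b b' hbb' => by
    obtain ⟨c, hc⟩ := (Projectivization.mk_eq_mk_iff' ℝ _ _ _ _).1 (congrArg Subtype.val hbb')
    refine Subtype.ext ?_
    rw [← hρcap b, ← hρcap b']
    exact (h.cap_eq_cap_iff hE (hρ b') (hρ b)).2 ⟨c, hc.symm⟩
  have hsurj : Function.Surjective φ := fun ⟨p, hp⟩ => by
    obtain ⟨ω, hω, hω0, rfl⟩ := h.projVertices_eq hE ▸ hp
    exact ⟨⟨cap B v ω, Set.mem_image_of_mem _ hω⟩, Subtype.ext (hφ ω hω hω0)⟩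
  exact ⟨Equiv.ofBijective φ ⟨hinj, hsurj⟩, hφ⟩

theorem exists_iso_projSkeleton (h : IsLorentzPolytope B v Ω T) (hE : 3 ≤ Module.finrank ℝ E) :
    ∃ φ : tangencyGraph (cap B v '' Ω) ≃g projSkeleton T, ∀ (ω : E) (hω : ω ∈ Ω) (hω0 : ω ≠ 0),
      (φ ⟨cap B v ω, Set.mem_image_of_mem _ hω⟩ : ℙ ℝ E) = Projectivization.mk ℝ ω hω0 := by
  obtain ⟨φ, hφ⟩ := h.exists_equiv_projVertices hE
  refine ⟨⟨φ, fun {b b'} => ?_⟩, hφ⟩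
  obtain ⟨_, ω, hω, rfl⟩ := b
  obtain ⟨_, ω', hω', rfl⟩ := b'
  have hne : φ ⟨cap B v ω, Set.mem_image_of_mem _ hω⟩ ≠ φ ⟨cap B v ω', Set.mem_image_of_mem _ hω'⟩ →
      ∀ c : ℝ, ω' ≠ c • ω := fun hbb' c hc =>
    hbb' (congrArg φ (Subtype.ext ((h.cap_eq_cap_iff hE hω hω').2 ⟨c, hc⟩).symm))
  refine (and_congr_right fun hbb' => ?_).trans (and_congr_left' φ.injective.ne_iff)
  rw [hφ ω hω (h.ne_zero hω), hφ ω' hω' (h.ne_zero hω')]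
  exact (h.exists_edge_iff hE hω hω' (hne hbb') _ _).trans
    (h.exists_cap_inter_eq_singleton_iff hω hω' (hne hbb')).symm

end Isomorphism

end IsLorentzPolytope

/-! ### Alternating suffixes in Coxeter groups -/

section AlternatingSuffixes

open CoxeterSystem (alternatingWord)

variable {I : Type*} {M : CoxeterMatrix I} {W : Type*} [Group W] (cs : CoxeterSystem M W)

/-- The element `w` has a reduced expression ending in the alternating word of length `k` in `s` and
`t`, and `u` is the remaining left factor. -/
structure IsAlternatingSuffix (s t : I) (w u : W) (k : ℕ) : Prop where
  eq_mul : w = u * cs.wordProd (alternatingWord s t k)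
  length_add : cs.length u + k = cs.length w

variable {cs} {s t : I} {w u : W} {k : ℕ}

theorem isAlternatingSuffix_one (ht : cs.IsRightDescent w t) :
    IsAlternatingSuffix cs s t w (w * cs.simple t) 1 where
  eq_mul := by simp [alternatingWord]
  length_add := cs.isRightDescent_iff.1 ht

namespace IsAlternatingSuffix

theorem succ (h : IsAlternatingSuffix cs s t w u k)
    (hu : cs.IsRightDescent u (if Even k then t else s)) :
    IsAlternatingSuffix cs s t w (u * cs.simple (if Even k then t else s)) (k + 1) where
  eq_mul := by
    rw [CoxeterSystem.alternatingWord_succ', cs.wordProd_cons, mul_assoc,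
      cs.simple_mul_simple_cancel_left, h.eq_mul]
  length_add := by
    have hlength := cs.isRightDescent_iff.1 hu
    have := h.length_add
    omega

theorem not_isRightDescent_head (h : IsAlternatingSuffix cs s t w u (k + 1)) :
    ¬ cs.IsRightDescent u (if Even k then t else s) := by
  intro hu
  have hw : w = u * cs.simple (if Even k then t else s) * cs.wordProd (alternatingWord s t k) := by
    rw [h.eq_mul, CoxeterSystem.alternatingWord_succ', cs.wordProd_cons, mul_assoc]
  have hlength := cs.isRightDescent_iff.1 hu
  have hmul := cs.length_mul_le (u * cs.simple (if Even k then t else s))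
    (cs.wordProd (alternatingWord s t k))
  have hword := cs.length_wordProd_le (alternatingWord s t k)
  rw [CoxeterSystem.length_alternatingWord] at hword
  rw [← hw] at hmul
  have := h.length_add
  omega

theorem exists_maximal (ht : cs.IsRightDescent w t) :
    ∃ u k, 0 < k ∧ IsAlternatingSuffix cs s t w u k ∧
      ¬ cs.IsRightDescent u s ∧ ¬ cs.IsRightDescent u t := by
  classical
  let HasSuffix : ℕ → Prop := fun k => ∃ u, IsAlternatingSuffix cs s t w u k
  have hle : ∀ k, HasSuffix k → k ≤ cs.length w := fun k ⟨u, hu⟩ => by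
    have := hu.length_add
    omega
  have hone : HasSuffix 1 := ⟨_, isAlternatingSuffix_one ht⟩
  obtain ⟨k, ⟨u, hu⟩, hmax⟩ : ∃ k, HasSuffix (k + 1) ∧ ¬ HasSuffix (k + 2) := by
    have hpos := Nat.le_findGreatest (hle 1 hone) hone
    refine ⟨Nat.findGreatest HasSuffix (cs.length w) - 1, ?_, fun hk => ?_⟩
    · rw [Nat.sub_add_cancel hpos]
      exact Nat.findGreatest_spec (hle 1 hone) hone
    · have := Nat.le_findGreatest (hle _ hk) hk
      omega
  have hnext : ¬ cs.IsRightDescent u (if Even (k + 1) then t else s) := fun hd =>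
    hmax ⟨_, hu.succ hd⟩
  have hprev := hu.not_isRightDescent_head
  refine ⟨u, k + 1, k.succ_pos, hu, ?_⟩
  by_cases hk : Even k
  · simp only [hk, parity_simps, not_true_eq_false, if_false, if_true] at hnext hprev
    exact ⟨hnext, hprev⟩
  · simp only [hk, parity_simps, not_false_eq_true, if_false, if_true] at hnext hprev
    exact ⟨hprev, hnext⟩

theorem isRightDescent_of_eq (h : IsAlternatingSuffix cs s t w u (M s t)) (hM : M s t ≠ 0) :
    cs.IsRightDescent w s := by
  obtain ⟨m, hm⟩ : ∃ m, M s t = m + 1 := Nat.exists_eq_succ_of_ne_zero hM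
  have hbraid : cs.wordProd (alternatingWord s t (M s t)) =
      cs.wordProd (alternatingWord s t m) * cs.simple s := by
    rw [cs.wordProd_braidWord_eq s t, CoxeterSystem.braidWord, M.symmetric t s, hm,
      CoxeterSystem.alternatingWord_succ, cs.wordProd_concat]
  have hws : w * cs.simple s = u * cs.wordProd (alternatingWord s t m) := by
    rw [h.eq_mul, hbraid, ← mul_assoc, cs.simple_mul_simple_cancel_right]
  have hmul := cs.length_mul_le u (cs.wordProd (alternatingWord s t m))
  have hword := cs.length_wordProd_le (alternatingWord s t m)
  rw [CoxeterSystem.length_alternatingWord] at hword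
  have := h.length_add
  rw [CoxeterSystem.IsRightDescent, hws]
  omega

theorem lt_of_not_isRightDescent (h : IsAlternatingSuffix cs s t w u k) (hM : M s t ≠ 0)
    (hs : ¬ cs.IsRightDescent w s) : k < M s t := by
  by_contra! hk
  obtain rfl | hk := hk.eq_or_lt
  · exact hs (h.isRightDescent_of_eq hM)
  have hlt := (cs.length_wordProd_le (alternatingWord s t k)).lt_of_ne
    (cs.not_isReduced_alternatingWord s t hM hk)
  rw [CoxeterSystem.length_alternatingWord] at hlt
  have hmul := cs.length_mul_le u (cs.wordProd (alternatingWord s t k))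
  rw [← h.eq_mul] at hmul
  have := h.length_add
  omega

end IsAlternatingSuffix

end AlternatingSuffixes

namespace GeometricCoxeterMatrix

variable {S : Type*} (G : GeometricCoxeterMatrix S)

/-! ### The Gram matrix and the geometric representation -/

theorem pi_div_mem_Ioc {s t : S} (h : s ≠ t) (h0 : G.M s t ≠ 0) :
    Real.pi / G.M s t ∈ Set.Ioc 0 (Real.pi / 2) := by
  have h1 : G.M s t ≠ 1 := G.M.off_diagonal s t h
  have h2 : (2 : ℝ) ≤ G.M s t := by exact_mod_cast (by omega : 2 ≤ G.M s t)
  exact ⟨by positivity, div_le_div_of_nonneg_left Real.pi_pos.le two_pos h2⟩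

theorem gram_nonpos {s t : S} (h : s ≠ t) : G.gram s t ≤ 0 := by
  unfold gram
  split_ifs with h0
  · linarith [G.one_le_c s t h0]
  · have hangle := G.pi_div_mem_Ioc h h0
    exact neg_nonpos.2 (Real.cos_nonneg_of_neg_pi_div_two_le_of_le
      (by linarith [hangle.1, Real.pi_pos]) hangle.2)

theorem gram_neg_of_adj {s t : S} (h : G.coxeterGraph.Adj s t) : G.gram s t < 0 := by
  unfold gram
  split_ifs with h0
  · linarith [G.one_le_c s t h0]
  · have hangle := G.pi_div_mem_Ioc h.1 h0
    have hne : Real.pi / G.M s t ≠ Real.pi / 2 := fun heq => h.2 <| by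
      have htwo : (G.M s t : ℝ) = 2 := by simpa [div_eq_mul_inv, Real.pi_ne_zero] using heq
      exact_mod_cast htwo
    exact neg_lt_zero.2 (Real.cos_pos_of_mem_Ioo
      ⟨by linarith [hangle.1, Real.pi_pos], hangle.2.lt_of_ne hne⟩)

/-- The coefficient `U_{k-1}(c)` of a root of the dihedral group generated by two reflections
`s`, `t` with `B_{st} = -c`: applying `k` alternating reflections to `α_s` gives a combination of
`α_s` and `α_t` with coefficients `U_k(c)` and `U_{k-1}(c)`. The index is shifted so that the
family starts with `0` and `1`. -/
def dihedralCoeff (c : ℝ) (k : ℕ) : ℝ := (Polynomial.Chebyshev.U ℝ ((k : ℤ) - 1)).eval c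

theorem dihedralCoeff_zero (c : ℝ) : dihedralCoeff c 0 = 0 := by simp [dihedralCoeff]

theorem dihedralCoeff_one (c : ℝ) : dihedralCoeff c 1 = 1 := by simp [dihedralCoeff]

theorem dihedralCoeff_add_two (c : ℝ) (k : ℕ) :
    dihedralCoeff c (k + 2) = 2 * c * dihedralCoeff c (k + 1) - dihedralCoeff c k := by
  have hrec := Polynomial.Chebyshev.U_add_two ℝ ((k : ℤ) - 1)
  have htwo : ((k + 2 : ℕ) : ℤ) - 1 = (k : ℤ) - 1 + 2 := by push_cast; ring
  have hone : ((k + 1 : ℕ) : ℤ) - 1 = (k : ℤ) - 1 + 1 := by push_cast; ring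
  unfold dihedralCoeff
  rw [htwo, hone, hrec]
  simp

theorem dihedralCoeff_nonneg_of_one_le {c : ℝ} (hc : 1 ≤ c) (k : ℕ) : 0 ≤ dihedralCoeff c k := by
  suffices 0 ≤ dihedralCoeff c k ∧ dihedralCoeff c k ≤ dihedralCoeff c (k + 1) from this.1
  induction k with
  | zero => simp [dihedralCoeff_zero, dihedralCoeff_one]
  | succ k ih =>
    refine ⟨ih.1.trans ih.2, ?_⟩
    rw [dihedralCoeff_add_two]
    nlinarith

theorem dihedralCoeff_cos_mul_sin (θ : ℝ) (k : ℕ) :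
    dihedralCoeff (Real.cos θ) k * Real.sin θ = Real.sin (k * θ) := by
  have h := Polynomial.Chebyshev.U_real_cos θ ((k : ℤ) - 1)
  push_cast at h
  rwa [sub_add_cancel] at h

theorem dihedralCoeff_cos_nonneg {m k : ℕ} (hm : 2 ≤ m) (hk : k ≤ m) :
    0 ≤ dihedralCoeff (Real.cos (Real.pi / m)) k := by
  have hm' : (2 : ℝ) ≤ m := by exact_mod_cast hm
  have hk' : (k : ℝ) ≤ m := by exact_mod_cast hk
  have hsin : 0 < Real.sin (Real.pi / m) :=
    Real.sin_pos_of_pos_of_lt_pi (by positivity) (div_lt_self Real.pi_pos (by linarith))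
  refine nonneg_of_mul_nonneg_left ?_ hsin
  rw [dihedralCoeff_cos_mul_sin, mul_div_left_comm]
  exact Real.sin_nonneg_of_nonneg_of_le_pi (by positivity)
    (mul_le_of_le_one_right Real.pi_pos.le ((div_le_one (by linarith)).2 hk'))

theorem dihedralCoeff_neg_gram_nonneg {s t : S} (hst : s ≠ t) {k : ℕ}
    (hk : G.M s t ≠ 0 → k ≤ G.M s t) : 0 ≤ dihedralCoeff (-G.gram s t) k := by
  by_cases hM : G.M s t = 0
  · exact dihedralCoeff_nonneg_of_one_le (by simp [gram, hM, G.one_le_c s t hM]) k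
  · have hM1 : G.M s t ≠ 1 := G.M.off_diagonal s t hst
    have hcos : -G.gram s t = Real.cos (Real.pi / G.M s t) := by simp [gram, hM]
    rw [hcos]
    exact dihedralCoeff_cos_nonneg (by omega) (hk hM)

theorem simpleRoot_nonneg [DecidableEq S] (s : S) : 0 ≤ simpleRoot s :=
  Pi.single_nonneg.2 zero_le_one

variable [Fintype S] [DecidableEq S]

theorem isSymm_form : G.form.IsSymm :=
  Matrix.isSymm_toBilin'_iff_isSymm.2 (Matrix.IsSymm.ext fun s t => G.gram_comm t s)

theorem form_comm (x y : S → ℝ) : G.form x y = G.form y x := G.isSymm_form.eq x y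

theorem eq_sum_smul_simpleRoot (x : S → ℝ) : x = ∑ s, x s • simpleRoot s := by
  ext t
  simp [simpleRoot, Finset.sum_apply, Pi.single_apply]

theorem form_eq_sum (x y : S → ℝ) : G.form x y = ∑ s, y s * G.form x (simpleRoot s) := by
  conv_lhs => rw [eq_sum_smul_simpleRoot y]
  simp

theorem form_simpleRoot_eq_sum (x : S → ℝ) (t : S) :
    G.form x (simpleRoot t) = ∑ s, x s * G.gram s t := by
  rw [form_comm, form_eq_sum]
  exact Finset.sum_congr rfl fun s _ => by rw [form_simpleRoot, gram_comm]

theorem form_simpleRoot_nonpos {x : S → ℝ} (hx : 0 ≤ x) {t : S} (ht : x t = 0) :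
    G.form x (simpleRoot t) ≤ 0 := by
  rw [form_simpleRoot_eq_sum]
  refine Finset.sum_nonpos fun s _ => ?_
  by_cases h : s = t
  · rw [h, ht, zero_mul]
  · exact mul_nonpos_of_nonneg_of_nonpos (hx s) (G.gram_nonpos h)

theorem continuous_form_left (y : S → ℝ) : Continuous fun x => G.form x y :=
  (G.form.flip y).continuous_of_finiteDimensional

theorem continuous_form_right (y : S → ℝ) : Continuous fun x => G.form y x :=
  (G.form y).continuous_of_finiteDimensional

theorem continuous_form_self : Continuous fun x => G.form x x := by
  simp_rw [fun x => G.form_eq_sum x x]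
  exact continuous_finsetSum _ fun s _ => (continuous_apply s).mul (G.continuous_form_left _)

theorem form_simpleReflection (s : S) (x y : S → ℝ) :
    G.form (G.simpleReflection s x) (G.simpleReflection s y) = G.form x y := by
  simp only [simpleReflection_apply, map_sub, map_smul, LinearMap.sub_apply, LinearMap.smul_apply,
    smul_eq_mul, form_simpleRoot, gram_self, G.form_comm (simpleRoot s) y]
  ring

theorem simpleReflection_simpleReflection (t : S) (x : S → ℝ) :
    G.simpleReflection t (G.simpleReflection t x) = x :=
  Module.involutive_reflection (G.coroot_self t) x

variable {G} {W : Type*} [Group W] (cs : CoxeterSystem G.M W)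

theorem geometricRep_simple (s : S) : geometricRep cs (cs.simple s) = G.simpleReflection s :=
  cs.lift_apply_simple G.isLiftable s

theorem geometricRep_mul_apply (w w' : W) (x : S → ℝ) :
    geometricRep cs (w * w') x = geometricRep cs w (geometricRep cs w' x) := by
  rw [map_mul]; rfl

theorem geometricRep_one_apply (x : S → ℝ) : geometricRep cs 1 x = x := by
  rw [map_one]; rfl

theorem form_geometricRep (w : W) (x y : S → ℝ) :
    G.form (geometricRep cs w x) (geometricRep cs w y) = G.form x y := by
  induction w using cs.simple_induction_left generalizing x y with
  | one => simp only [geometricRep_one_apply]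
  | mul_simple_left w s ih =>
    rw [geometricRep_mul_apply, geometricRep_mul_apply, geometricRep_simple,
      form_simpleReflection, ih]

theorem form_geometricRep_left (w : W) (x y : S → ℝ) :
    G.form (geometricRep cs w x) y = G.form x (geometricRep cs w⁻¹ y) := by
  rw [← form_geometricRep cs w⁻¹, ← geometricRep_mul_apply, inv_mul_cancel,
    geometricRep_one_apply]

/-! ### Positive roots -/

theorem geometricRep_alternatingWord (s t : S) (k : ℕ) :
    geometricRep cs (cs.wordProd (CoxeterSystem.alternatingWord s t k)) (simpleRoot s) =
      if Even k then dihedralCoeff (-G.gram s t) (k + 1) • simpleRoot s +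
        dihedralCoeff (-G.gram s t) k • simpleRoot t
      else dihedralCoeff (-G.gram s t) (k + 1) • simpleRoot t +
        dihedralCoeff (-G.gram s t) k • simpleRoot s := by
  induction k with
  | zero =>
    simp [CoxeterSystem.alternatingWord, dihedralCoeff_zero, dihedralCoeff_one]
  | succ k ih =>
    rw [CoxeterSystem.alternatingWord_succ', cs.wordProd_cons, geometricRep_mul_apply, ih,
      geometricRep_simple]
    by_cases hk : Even k
    · have hk' : ¬ Even (k + 1) := by simp [hk, parity_simps]
      rw [if_pos hk, if_pos hk, if_neg hk', dihedralCoeff_add_two, simpleReflection_apply]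
      simp only [map_add, map_smul, LinearMap.add_apply, LinearMap.smul_apply, form_simpleRoot,
        gram_self, smul_eq_mul]
      module
    · have hk' : Even (k + 1) := by simp [hk, parity_simps]
      rw [if_neg hk, if_neg hk, if_pos hk', dihedralCoeff_add_two, simpleReflection_apply]
      simp only [map_add, map_smul, LinearMap.add_apply, LinearMap.smul_apply, form_simpleRoot,
        gram_self, smul_eq_mul, G.gram_comm t s]
      module

theorem geometricRep_simpleRoot_nonneg (w : W) (s : S) (h : ¬ cs.IsRightDescent w s) :
    0 ≤ geometricRep cs w (simpleRoot s) := by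
  induction hn : cs.length w using Nat.strong_induction_on generalizing w s with
  | _ n ih =>
  subst hn
  by_cases hw : w = 1
  · rw [hw, geometricRep_one_apply]
    exact simpleRoot_nonneg s
  obtain ⟨t, ht⟩ := cs.exists_rightDescent_of_ne_one hw
  have hst : s ≠ t := by rintro rfl; exact h ht
  obtain ⟨u, k, hk, hu, hus, hut⟩ := IsAlternatingSuffix.exists_maximal (s := s) ht
  have hlt : cs.length u < cs.length w := by have := hu.length_add; omega
  have hks : G.M s t ≠ 0 → k < G.M s t := fun hM => hu.lt_of_not_isRightDescent hM h
  have hcoeff := G.dihedralCoeff_neg_gram_nonneg hst fun hM => (hks hM).le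
  have hcoeff' := G.dihedralCoeff_neg_gram_nonneg hst (k := k + 1) hks
  have hroot_s := ih _ hlt u s hus rfl
  have hroot_t := ih _ hlt u t hut rfl
  rw [hu.eq_mul, geometricRep_mul_apply, geometricRep_alternatingWord]
  split_ifs
  · rw [map_add, map_smul, map_smul]
    exact add_nonneg (smul_nonneg hcoeff' hroot_s) (smul_nonneg hcoeff hroot_t)
  · rw [map_add, map_smul, map_smul]
    exact add_nonneg (smul_nonneg hcoeff' hroot_t) (smul_nonneg hcoeff hroot_s)

theorem geometricRep_eq_sub (w : W) (s : S) (x : S → ℝ) :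
    geometricRep cs w x = geometricRep cs (w * cs.simple s) x -
      (2 * G.form x (simpleRoot s)) • geometricRep cs (w * cs.simple s) (simpleRoot s) := by
  conv_lhs => rw [← cs.simple_mul_simple_cancel_right (w := w) s]
  rw [geometricRep_mul_apply, geometricRep_simple, simpleReflection_apply, map_sub, map_smul]

theorem geometricRep_le_self {x : S → ℝ} (hx : ∀ s, 0 ≤ G.form x (simpleRoot s)) (w : W) :
    geometricRep cs w x ≤ x := by
  induction hn : cs.length w using Nat.strong_induction_on generalizing w with
  | _ n ih =>
  subst hn
  by_cases hw : w = 1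
  · rw [hw, geometricRep_one_apply]
  obtain ⟨s, hs⟩ := cs.exists_rightDescent_of_ne_one hw
  have hroot := geometricRep_simpleRoot_nonneg cs (w * cs.simple s) s
    (cs.isRightDescent_iff_not_isRightDescent_mul.1 hs)
  rw [geometricRep_eq_sub cs w s]
  exact (sub_le_self _ (smul_nonneg (mul_nonneg zero_le_two (hx s)) hroot)).trans (ih _ hs _ rfl)

end GeometricCoxeterMatrix

/-! ### Rayleigh quotients and Perron vectors -/

section Rayleigh

variable {E : Type*} [NormedAddCommGroup E] [NormedSpace ℝ E]

theorem exists_forall_rayleigh_mul_le [FiniteDimensional ℝ E] (B : LinearMap.BilinForm ℝ E)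
    {D : LinearMap.BilinForm ℝ E} (hD : ∀ x ≠ 0, 0 < D x x) {K : Submodule ℝ E} (hK : K ≠ ⊥) :
    ∃ y ∈ K, y ≠ 0 ∧ ∀ z ∈ K, B y y / D y y * D z z ≤ B z z := by
  have hcont : ∀ A : LinearMap.BilinForm ℝ E, Continuous fun x => A x x := fun A =>
    (A.toContinuousBilinearMap.continuous₂).comp (continuous_id.prodMk continuous_id)
  have hunit : ∀ z ∈ K, z ≠ 0 → ‖z‖⁻¹ • z ∈ (K : Set E) ∩ Metric.sphere 0 1 := fun z hz hz0 =>
    ⟨K.smul_mem _ hz, by simp [norm_smul, norm_ne_zero_iff.2 hz0]⟩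
  obtain ⟨x, hx, hx0⟩ := Submodule.exists_mem_ne_zero_of_ne_bot hK
  obtain ⟨y, hy, hmin⟩ := ((isCompact_sphere (0 : E) 1).inter_left K.closed_of_finiteDimensional
    ).exists_isMinOn ⟨_, hunit x hx hx0⟩ ((hcont B).continuousOn.div (hcont D).continuousOn
      fun z hz => (hD z (ne_zero_of_mem_unit_sphere ⟨z, hz.2⟩)).ne')
  refine ⟨y, hy.1, ne_zero_of_mem_unit_sphere ⟨y, hy.2⟩, fun z hz => ?_⟩
  rcases eq_or_ne z 0 with rfl | hz0
  · simp
  have hle : B y y / D y y ≤ B (‖z‖⁻¹ • z) (‖z‖⁻¹ • z) / D (‖z‖⁻¹ • z) (‖z‖⁻¹ • z) :=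
    hmin (hunit z hz hz0)
  have hnorm : ‖z‖⁻¹ ≠ 0 := inv_ne_zero (norm_ne_zero_iff.2 hz0)
  simp only [map_smul, LinearMap.smul_apply, smul_eq_mul] at hle
  rwa [mul_div_mul_left _ _ hnorm, mul_div_mul_left _ _ hnorm, le_div_iff₀ (hD z hz0)] at hle

end Rayleigh

theorem form_eq_zero_of_isotropic_of_nonneg {E : Type*} [AddCommGroup E] [Module ℝ E]
    {P : LinearMap.BilinForm ℝ E} (hP : P.IsSymm) {K : Submodule ℝ E} (hpos : ∀ z ∈ K, 0 ≤ P z z)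
    {x w : E} (hx : x ∈ K) (hxx : P x x = 0) (hw : w ∈ K) : P x w = 0 := by
  have hsq := (P.restrict K).apply_sq_le_of_symm (fun z => hpos z z.2) ⟨fun y z => hP.eq y z⟩
    ⟨x, hx⟩ ⟨w, hw⟩
  rw [LinearMap.BilinForm.restrict_apply] at hsq
  simpa [hxx, sq_nonpos_iff] using hsq

namespace GeometricCoxeterMatrix

variable {S : Type*} {G : GeometricCoxeterMatrix S} [Fintype S]

theorem three_le_card_of_not_levelLE_one (h : ¬ G.LevelLE 1) : 3 ≤ Fintype.card S := by
  by_contra! hcard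
  refine h fun I hI => ?_
  have : Subsingleton I := Finset.card_le_one_iff_subsingleton_coe.1 (by omega)
  have hone : G.gram.submatrix (Subtype.val : I → S) (Subtype.val : I → S) = 1 := by
    ext i j
    obtain rfl := Subsingleton.elim i j
    simp [gram_self]
  rw [hone]
  exact Matrix.PosSemidef.one

variable [DecidableEq S] {v : S → ℝ}

theorem form_abs_le (x : S → ℝ) : G.form |x| |x| ≤ G.form x x := by
  simp only [form, Matrix.toBilin'_apply]
  refine Finset.sum_le_sum fun s _ => Finset.sum_le_sum fun t _ => ?_
  rcases eq_or_ne s t with rfl | hst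
  · simp [gram_self]
  · have habs : x s * x t ≤ |x| s * |x| t := by
      simpa [abs_mul] using le_abs_self (x s * x t)
    linarith [mul_le_mul_of_nonpos_right habs (G.gram_nonpos hst)]

theorem exists_perronFrobenius (J : Set S) {x : S → ℝ} (hx : ∀ s ∉ J, x s = 0)
    (hxx : G.form x x < 0) :
    ∃ (y : S → ℝ) (μ : ℝ), 0 ≤ y ∧ y ≠ 0 ∧ (∀ s ∉ J, y s = 0) ∧ μ < 0 ∧
      (∀ s ∈ J, G.form y (simpleRoot s) = μ * y s) ∧ G.form y y < 0 := by
  let D : LinearMap.BilinForm ℝ (S → ℝ) := dotProductBilin ℝ ℝ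
  let K : Submodule ℝ (S → ℝ) := Submodule.pi Jᶜ fun _ => ⊥
  have hD : ∀ z ≠ 0, 0 < D z z := fun z hz => by
    simpa [D] using (Matrix.dotProduct_self_star_pos_iff (v := z)).2 hz
  have hDsymm : D.IsSymm := ⟨fun y z => dotProduct_comm y z⟩
  have hx0 : x ≠ 0 := by rintro rfl; simp at hxx
  have hxK : x ∈ K := by simpa [K, Submodule.mem_pi] using hx
  obtain ⟨y, hy, hy0, hmin⟩ := exists_forall_rayleigh_mul_le G.form hD
    (Submodule.ne_bot_iff K |>.2 ⟨x, hxK, hx0⟩)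
  set μ := G.form y y / D y y with hμ_def
  have hμ : μ < 0 := neg_of_mul_neg_left ((hmin x hxK).trans_lt hxx) (hD x hx0).le
  have habs : |y| ∈ K := by simpa [K, Submodule.mem_pi] using hy
  have habs0 : |y| ≠ 0 := by simpa using hy0
  have hDabs : D |y| |y| = D y y := by simp [D, dotProduct, abs_mul_abs_self]
  have hself : G.form |y| |y| = μ * D |y| |y| := by
    refine le_antisymm ?_ (hmin _ habs)
    rw [hDabs, hμ_def, div_mul_cancel₀ _ (hD y hy0).ne']
    exact form_abs_le y
  have hcritical : ∀ w ∈ K, (G.form - μ • D) |y| w = 0 := fun w hw =>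
    form_eq_zero_of_isotropic_of_nonneg (G.isSymm_form.sub (hDsymm.smul μ))
      (fun z hz => by simpa using hmin z hz) habs (by simp [hself]) hw
  refine ⟨|y|, μ, abs_nonneg y, habs0, by simpa [K, Submodule.mem_pi] using habs, hμ,
    fun s hs => ?_, hself.trans_lt (mul_neg_of_neg_of_pos hμ (hD _ habs0))⟩
  have hsK : simpleRoot s ∈ K := by
    simp only [K, Submodule.mem_pi, simpleRoot]
    exact fun t ht => Pi.single_eq_of_ne (ne_of_mem_of_not_mem hs ht).symm _
  simpa [D, simpleRoot, sub_eq_zero] using hcritical _ hsK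

variable (G) in
/-- A positive eigenvector of the Gram matrix for a negative eigenvalue. It is time-like and fixes
the time orientation: `-v` is future-directed. -/
structure IsPerronVector (v : S → ℝ) : Prop where
  pos : ∀ s, 0 < v s
  eigen : ∃ μ < 0, ∀ s, G.form v (simpleRoot s) = μ * v s

namespace IsPerronVector

theorem form_simpleRoot_neg (hv : G.IsPerronVector v) (s : S) : G.form v (simpleRoot s) < 0 := by
  obtain ⟨μ, hμ, heigen⟩ := hv.eigen
  rw [heigen]
  exact mul_neg_of_neg_of_pos hμ (hv.pos s)

theorem form_self_neg [Nonempty S] (hv : G.IsPerronVector v) : G.form v v < 0 := by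
  rw [form_eq_sum]
  exact Finset.sum_neg (fun s _ => mul_neg_of_pos_of_neg (hv.pos s) (hv.form_simpleRoot_neg s))
    Finset.univ_nonempty

theorem form_nonpos (hv : G.IsPerronVector v) {x : S → ℝ} (hx : 0 ≤ x) : G.form x v ≤ 0 := by
  rw [form_comm, form_eq_sum]
  exact Finset.sum_nonpos fun s _ =>
    mul_nonpos_of_nonneg_of_nonpos (hx s) (hv.form_simpleRoot_neg s).le

end IsPerronVector

theorem eq_zero_of_adj {y : S → ℝ} {μ : ℝ} {s t : S} (hy : 0 ≤ y)
    (hs : G.form y (simpleRoot s) = μ * y s) (hst : G.coxeterGraph.Adj s t) (hys : y s = 0) :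
    y t = 0 := by
  rw [hys, mul_zero, form_simpleRoot_eq_sum] at hs
  have hnonpos : ∀ u ∈ Finset.univ, y u * G.gram u s ≤ 0 := fun u _ => by
    rcases eq_or_ne u s with rfl | hus
    · rw [hys, zero_mul]
    · exact mul_nonpos_of_nonneg_of_nonpos (hy u) (G.gram_nonpos hus)
  have hzero := (Finset.sum_eq_zero_iff_of_nonpos hnonpos).1 hs t (Finset.mem_univ t)
  exact (mul_eq_zero.1 hzero).resolve_right (G.gram_neg_of_adj hst.symm).ne

theorem exists_isPerronVector (hirr : G.IsIrreducible) (hneg : ∃ x, G.form x x < 0) :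
    ∃ v, G.IsPerronVector v := by
  obtain ⟨x, hx⟩ := hneg
  obtain ⟨y, μ, hy, hy0, -, hμ, heigen, -⟩ := exists_perronFrobenius Set.univ (by simp) hx
  refine ⟨y, fun s => (hy s).lt_of_ne' fun hs => hy0 ?_, μ, hμ, fun s => heigen s trivial⟩
  ext t
  induction (SimpleGraph.reachable_iff_reflTransGen s t).1 (hirr.preconnected s t) with
  | refl => exact hs
  | tail _ hadj ih => exact eq_zero_of_adj hy (heigen _ trivial) hadj ih

/-! ### Lorentzian Coxeter systems of level two -/

namespace IsLorentzian

theorem isLorentzForm (hlor : G.IsLorentzian) : IsLorentzForm G.form where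
  isSymm := G.isSymm_form
  exists_neg := by
    obtain ⟨V, hV, hneg⟩ := exists_finrank_eq_sigNeg_and_negDef G.form.toQuadraticMap
    have hbot : V ≠ ⊥ := by
      rintro rfl
      rw [hlor.2, finrank_bot] at hV
      exact zero_ne_one hV
    obtain ⟨x, hx, hx0⟩ := Submodule.exists_mem_ne_zero_of_ne_bot hbot
    exact ⟨x, by simpa using hneg ⟨x, hx⟩ (by simpa using hx0)⟩
  pos_of_orthogonal {x y} hx hxy hy0 := by
    by_contra! hyy
    have hyx : G.form y x = 0 := by rw [form_comm, hxy]
    have hnonpos : ∀ z ∈ Submodule.span ℝ {x, y}, G.form.toQuadraticMap z ≤ 0 := fun z hz => by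
      obtain ⟨a, b, rfl⟩ := Submodule.mem_span_pair.1 hz
      simp only [LinearMap.BilinMap.toQuadraticMap_apply, map_add, map_smul, LinearMap.add_apply,
        LinearMap.smul_apply, smul_eq_mul, hxy, hyx]
      nlinarith [mul_nonneg (mul_self_nonneg a) (neg_nonneg.2 hx.le),
        mul_nonneg (mul_self_nonneg b) (neg_nonneg.2 hyy)]
    have hrank := QuadraticForm.sigPos_add_finrank_le_of_nonpos hnonpos
    rw [finrank_span_pair_of_orthogonal hx.ne hy0 hyx, Module.finrank_fintype_fun_eq_card] at hrank
    have := hlor.1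
    omega

theorem nonempty (hlor : G.IsLorentzian) : Nonempty S := by
  obtain ⟨x, hx⟩ := hlor.isLorentzForm.exists_neg
  by_contra hempty
  rw [not_nonempty_iff] at hempty
  simp [Subsingleton.elim x 0] at hx

theorem isUnit_det (hlor : G.IsLorentzian) : IsUnit G.gram.det := by
  rw [isUnit_iff_ne_zero]
  intro hdet
  obtain ⟨x, hx0, hx⟩ := Matrix.exists_mulVec_eq_zero_iff.2 hdet
  refine hx0 (hlor.isLorentzForm.eq_zero_of_forall fun y => ?_)
  rw [form_comm, form, Matrix.toBilin'_apply', hx, dotProduct_zero]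

theorem form_fundamentalWeight (hlor : G.IsLorentzian) (x : S → ℝ) (s : S) :
    G.form x (G.fundamentalWeight s) = x s := by
  rw [form_comm, form_eq_sum]
  simp [G.form_comm (G.fundamentalWeight s),
    G.form_simpleRoot_fundamentalWeight hlor.isUnit_det]

theorem form_fundamentalWeight_simpleRoot (hlor : G.IsLorentzian) (s t : S) :
    G.form (G.fundamentalWeight s) (simpleRoot t) = if t = s then 1 else 0 := by
  rw [form_comm, G.form_simpleRoot_fundamentalWeight hlor.isUnit_det]

theorem eq_sum_smul_fundamentalWeight (hlor : G.IsLorentzian) (x : S → ℝ) :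
    x = ∑ s, G.form x (simpleRoot s) • G.fundamentalWeight s := by
  rw [← sub_eq_zero]
  refine hlor.isLorentzForm.eq_zero_of_forall fun y => ?_
  rw [form_eq_sum]
  refine Finset.sum_eq_zero fun t _ => ?_
  simp [LinearMap.sum_apply, hlor.form_fundamentalWeight_simpleRoot]

theorem fundamentalWeight_ne_zero (hlor : G.IsLorentzian) (s : S) :
    G.fundamentalWeight s ≠ 0 := by
  intro hzero
  simpa [hzero] using hlor.form_fundamentalWeight_simpleRoot s s

end IsLorentzian

section Level

theorem form_self_eq_dotProduct_submatrix {I : Finset S} {x : S → ℝ} (hx : ∀ s ∉ I, x s = 0) :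
    G.form x x = (fun i : I => x i) ⬝ᵥ
      (G.gram.submatrix (Subtype.val : I → S) (Subtype.val : I → S) *ᵥ fun i : I => x i) := by
  have hsum : ∀ f : S → ℝ, (∀ s ∉ I, f s = 0) → ∑ s, f s = ∑ i : I, f i := fun f hf => by
    rw [Finset.sum_coe_sort I f]
    exact (Finset.sum_subset (Finset.subset_univ I) fun s _ hs => hf s hs).symm
  rw [form, Matrix.toBilin'_apply', dotProduct, hsum _ fun s hs => by rw [hx s hs, zero_mul]]
  refine Finset.sum_congr rfl fun i _ => congrArg (x i * ·) ?_
  exact hsum _ fun s hs => by rw [hx s hs, mul_zero]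

theorem posSemidef_submatrix_iff (I : Finset S) :
    (G.gram.submatrix (Subtype.val : I → S) (Subtype.val : I → S)).PosSemidef ↔
      ∀ x : S → ℝ, (∀ s ∉ I, x s = 0) → 0 ≤ G.form x x := by
  constructor
  · intro hpsd x hx
    rw [form_self_eq_dotProduct_submatrix hx]
    simpa using hpsd.dotProduct_mulVec_nonneg fun i : I => x i
  · intro hnonneg
    refine Matrix.PosSemidef.of_dotProduct_mulVec_nonneg ?_ fun y => ?_
    · ext i j
      simp [G.gram_comm]
    · let x : S → ℝ := fun s => if hs : s ∈ I then y ⟨s, hs⟩ else 0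
      have hx : ∀ s ∉ I, x s = 0 := fun s hs => dif_neg hs
      have hxy : (fun i : I => x i) = y := by
        ext i
        simp [x]
      simpa [form_self_eq_dotProduct_submatrix hx, hxy] using hnonneg x hx

theorem LevelLE.form_self_nonneg (h : G.LevelLE 2) {r s : S} (hrs : r ≠ s) {x : S → ℝ}
    (hr : x r = 0) (hs : x s = 0) : 0 ≤ G.form x x := by
  refine (posSemidef_submatrix_iff ({r, s}ᶜ : Finset S)).1 (h _ ?_) x fun t ht => ?_
  · rw [← Finset.card_pair hrs, add_comm, Finset.card_add_card_compl]
  · have : t = r ∨ t = s := by simpa [or_iff_not_imp_left] using ht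
    rcases this with rfl | rfl <;> assumption

theorem exists_form_self_neg_of_not_levelLE_one (h : ¬ G.LevelLE 1) :
    ∃ (s : S) (x : S → ℝ), x s = 0 ∧ G.form x x < 0 := by
  unfold LevelLE at h
  push Not at h
  obtain ⟨I, hI, hpsd⟩ := h
  rw [posSemidef_submatrix_iff] at hpsd
  push Not at hpsd
  obtain ⟨x, hx, hneg⟩ := hpsd
  obtain ⟨s, hs⟩ : ∃ s, s ∉ I := by
    by_contra! hall
    rw [Finset.eq_univ_of_forall hall, Finset.card_univ] at hI
    omega
  exact ⟨s, x, hx s hs, hneg⟩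

theorem exists_spaceLike_fundamentalWeight (hlor : G.IsLorentzian) (h : ¬ G.LevelLE 1) :
    ∃ s, 0 < G.form (G.fundamentalWeight s) (G.fundamentalWeight s) := by
  obtain ⟨s, x, hxs, hneg⟩ := exists_form_self_neg_of_not_levelLE_one h
  refine ⟨s, hlor.isLorentzForm.pos_of_orthogonal hneg ?_ (hlor.fundamentalWeight_ne_zero s)⟩
  rw [hlor.form_fundamentalWeight, hxs]

theorem form_orthProj_fundamentalWeight_nonpos (hlor : G.IsLorentzian) (h : G.LevelLE 2)
    {s r : S} (hs : 0 < G.form (G.fundamentalWeight s) (G.fundamentalWeight s)) (hrs : r ≠ s) :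
    G.form (orthProj G.form (G.fundamentalWeight s) (G.fundamentalWeight r))
      (orthProj G.form (G.fundamentalWeight s) (G.fundamentalWeight r)) ≤ 0 := by
  by_contra! hππ
  have hB := hlor.isLorentzForm
  set π := orthProj G.form (G.fundamentalWeight s) (G.fundamentalWeight r)
  have hπs : G.form π (G.fundamentalWeight s) = 0 := form_orthProj hs.ne' _
  obtain ⟨u, hu⟩ := hB.exists_neg
  set u' := orthProj G.form (G.fundamentalWeight s) u
  set u'' := orthProj G.form π u' with hu''_def
  have hneg : G.form u'' u'' < 0 :=
    hB.form_orthProj_self_neg hππ (hB.form_orthProj_self_neg hs hu)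
  have hus : G.form u'' (G.fundamentalWeight s) = 0 := by
    rw [hu''_def, orthProj_apply]
    simp [hπs, u', form_orthProj hs.ne']
  have hur : G.form u'' (G.fundamentalWeight r) = 0 := by
    rw [form_eq_form_orthProj hus]
    exact form_orthProj hππ.ne' u'
  rw [hlor.form_fundamentalWeight] at hus hur
  exact hneg.not_ge (h.form_self_nonneg hrs hur hus)

theorem exists_perronFrobenius_of_spaceLike (hlor : G.IsLorentzian) (h : G.LevelLE 2) {s : S}
    (hs : 0 < G.form (G.fundamentalWeight s) (G.fundamentalWeight s)) :
    ∃ y : S → ℝ, 0 ≤ y ∧ y s = 0 ∧ (∀ t ≠ s, 0 < y t) ∧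
      (∀ t ≠ s, G.form y (simpleRoot t) < 0) ∧ G.form y y < 0 := by
  have hB := hlor.isLorentzForm
  obtain ⟨u, hu⟩ := hB.exists_neg
  have hπs := form_orthProj hs.ne' u
  rw [hlor.form_fundamentalWeight] at hπs
  obtain ⟨y, μ, hy, -, hyJ, hμ, heigen, hyy⟩ :=
    exists_perronFrobenius {s}ᶜ (by simpa using hπs) (hB.form_orthProj_self_neg hs hu)
  have hys : y s = 0 := hyJ s (by simp)
  have hpos : ∀ t ≠ s, 0 < y t := fun t hts =>
    (hy t).lt_of_ne' fun hyt => hyy.not_ge (h.form_self_nonneg hts hyt hys)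
  refine ⟨y, hy, hys, hpos, fun t hts => ?_, hyy⟩
  rw [heigen t hts]
  exact mul_neg_of_neg_of_pos hμ (hpos t hts)

end Level

section FundamentalWeights

theorem form_posPart_self_nonpos {x : S → ℝ} (hx : ∀ s, 0 < x s → G.form x (simpleRoot s) ≤ 0) :
    G.form x⁺ x⁺ ≤ 0 := by
  rw [form_eq_sum]
  refine Finset.sum_nonpos fun s _ => ?_
  rcases le_or_gt (x s) 0 with hs | hs
  · simp [hs]
  refine mul_nonpos_of_nonneg_of_nonpos (posPart_nonneg x s) ?_
  have hneg := G.form_simpleRoot_nonpos (negPart_nonneg x) (t := s) (by simp [hs.le])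
  rw [← sub_add_cancel x⁺ x⁻, posPart_sub_negPart, map_add, LinearMap.add_apply]
  linarith [hx s hs]

theorem fundamentalWeight_nonpos [Nonempty S] (hlor : G.IsLorentzian) (hv : G.IsPerronVector v)
    {r : S} (hr : G.form (G.fundamentalWeight r) (G.fundamentalWeight r) ≤ 0) :
    G.fundamentalWeight r ≤ 0 := by
  set ω := G.fundamentalWeight r
  have hωr : ω r ≤ 0 := by rwa [← hlor.form_fundamentalWeight ω r]
  have hωv : 0 < G.form ω v := by
    rw [form_comm, hlor.form_fundamentalWeight]
    exact hv.pos r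
  have hposPart : -ω⁺ ∈ pastCone G.form v := by
    refine ⟨?_, by simpa using hv.form_nonpos (posPart_nonneg ω)⟩
    simpa using form_posPart_self_nonpos fun s hs => by
      rw [hlor.form_fundamentalWeight_simpleRoot, if_neg]
      rintro rfl
      exact hωr.not_gt hs
  obtain ⟨c, hc⟩ := hlor.isLorentzForm.exists_eq_smul_of_mem_pastCone hv.form_self_neg
    ⟨hr, hωv.le⟩ hposPart (hlor.fundamentalWeight_ne_zero r) (by
      rw [form_comm, hlor.form_fundamentalWeight]
      simpa using hωr)
  have hc0 : 0 ≤ c := by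
    have hpast := hposPart.2
    rw [hc, map_smul, LinearMap.smul_apply, smul_eq_mul] at hpast
    exact nonneg_of_mul_nonneg_left hpast hωv
  intro s
  by_contra! hs
  have hs' : 0 < ω s := hs
  have heq : -ω s = c * ω s := by simpa [hs'.le] using congrFun hc s
  linarith [mul_nonneg hc0 hs'.le]

end FundamentalWeights

section Balls

theorem IsPerronVector.form_eq_sum (hv : G.IsPerronVector v) :
    ∃ μ < 0, ∀ x, G.form x v = μ * ∑ s, v s * x s := by
  obtain ⟨μ, hμ, heigen⟩ := hv.eigen
  refine ⟨μ, hμ, fun x => ?_⟩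
  rw [form_comm, G.form_eq_sum, Finset.mul_sum]
  exact Finset.sum_congr rfl fun s _ => by rw [heigen]; ring

theorem IsPerronVector.isHeight [Nonempty S] (hlor : G.IsLorentzian) (hv : G.IsPerronVector v) :
    G.IsHeight v := by
  obtain ⟨μ, -, hform⟩ := hv.form_eq_sum
  refine ⟨hv.pos, fun z hz hheight => ?_⟩
  refine hlor.isLorentzForm.eq_zero_of_orthogonal hv.form_self_neg ?_ (le_of_eq hz)
  rw [form_comm, hform, hheight, mul_zero]

theorem IsHeight.exists_mem_pastCone [Nonempty S] (hlor : G.IsLorentzian)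
    (hS : 3 ≤ Fintype.card S) (hv : G.IsPerronVector v) {c : S → ℝ} (hc : G.IsHeight c) :
    ∃ u ∈ pastCone G.form v, ∀ x, G.form u x = ∑ s, c s * x s := by
  obtain ⟨u, hu⟩ := hlor.isLorentzForm.exists_form_eq (∑ s, c s • LinearMap.proj s)
  have hux : ∀ x, G.form u x = ∑ s, c s * x s := fun x => by simp [hu, LinearMap.sum_apply]
  have huv : 0 < G.form u v := by
    rw [hux]
    exact Finset.sum_pos (fun s _ => mul_pos (hc.1 s) (hv.pos s)) Finset.univ_nonempty
  have hu0 : u ≠ 0 := by rintro rfl; simp at huv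
  exact ⟨u, ⟨(hlor.isLorentzForm.form_self_neg_of_forall_lightlike
    (by rwa [Module.finrank_fintype_fun_eq_card]) hu0
    fun x hx hxu => hc.2 x hx (by rw [← hux, hxu])).le, huv.le⟩, hux⟩

theorem futureDirected_iff [Nonempty S] (hlor : G.IsLorentzian) (hS : 3 ≤ Fintype.card S)
    (hv : G.IsPerronVector v) {x : S → ℝ} (hx : G.form x x = 0) :
    G.FutureDirected x ↔ G.form x v < 0 := by
  constructor
  · rintro ⟨c, hc, hcx⟩
    obtain ⟨u, hu, hux⟩ := hc.exists_mem_pastCone hlor hS hv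
    by_contra! hxv
    rw [← hux] at hcx
    exact hcx.not_ge
      (hlor.isLorentzForm.form_nonpos_of_mem_pastCone hv.form_self_neg hu ⟨hx.le, hxv⟩)
  · intro hxv
    obtain ⟨μ, hμ, hform⟩ := hv.form_eq_sum
    rw [hform] at hxv
    exact ⟨v, hv.isHeight hlor, pos_of_mul_neg_right hxv hμ.le⟩

theorem ball_eq_cap [Nonempty S] (hlor : G.IsLorentzian) (hS : 3 ≤ Fintype.card S)
    (hv : G.IsPerronVector v) : G.ball = cap G.form v := by
  have hmk : ∀ (x : S → ℝ) (hx0 : x ≠ 0),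
      Projectivization.mk ℝ (-x) (neg_ne_zero.2 hx0) = Projectivization.mk ℝ x hx0 :=
    fun x _ => (Projectivization.mk_eq_mk_iff' ℝ _ _ _ _).2 ⟨-1, by simp⟩
  funext ω
  ext p
  constructor
  · rintro ⟨x, ⟨hxx, hfuture, hωx⟩, hx0, rfl⟩
    replace hxx : G.form x x = 0 := hxx
    rw [futureDirected_iff hlor hS hv hxx] at hfuture
    exact ⟨-x, ⟨⟨by simp [hxx], by simpa using hfuture.le⟩, by simpa using hxx, by simpa using hωx⟩,
      neg_ne_zero.2 hx0, hmk x hx0⟩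
  · rintro ⟨x, ⟨hpast, hxx, hωx⟩, hx0, rfl⟩
    have hneg : G.form (-x) (-x) = 0 := by simpa using hxx
    have hxv := hlor.isLorentzForm.form_pos_of_mem_pastCone hv.form_self_neg hpast hx0
    exact ⟨-x, ⟨hneg, (futureDirected_iff hlor hS hv hneg).2 (by simpa using hxv),
      by simpa using hωx⟩, neg_ne_zero.2 hx0, hmk x hx0⟩

end Balls

end GeometricCoxeterMatrix

/-! ### The Tits cone -/

namespace GeometricCoxeterMatrix

variable {S : Type*} {G : GeometricCoxeterMatrix S} [Fintype S] [DecidableEq S] {v : S → ℝ}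

theorem form_nonpos_of_forall_simpleRoot {x y : S → ℝ} (hx : ∀ s, G.form x (simpleRoot s) ≤ 0)
    (hy : 0 ≤ y) : G.form x y ≤ 0 := by
  rw [form_eq_sum]
  exact Finset.sum_nonpos fun s _ => mul_nonpos_of_nonneg_of_nonpos (hy s) (hx s)

theorem IsLorentzian.eq_zero_of_forall_simpleRoot (hlor : G.IsLorentzian) {x : S → ℝ}
    (hx : ∀ s, G.form x (simpleRoot s) = 0) : x = 0 := by
  rw [hlor.eq_sum_smul_fundamentalWeight x]
  simp [hx]

section ImaginaryChamber

variable {J : Set S}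

variable (G) in
/-- The imaginary chamber of the standard parabolic subgroup generated by `J`: the nonnegative
combinations of the simple roots in `J` on which all simple coroots are nonpositive. -/
def imaginaryChamber (J : Set S) : Set (S → ℝ) :=
  {y | 0 ≤ y ∧ (∀ s ∉ J, y s = 0) ∧ ∀ s, G.form y (simpleRoot s) ≤ 0}

theorem mem_imaginaryChamber_iff {y : S → ℝ} :
    y ∈ G.imaginaryChamber J ↔
      0 ≤ y ∧ (∀ s ∉ J, y s = 0) ∧ ∀ s ∈ J, G.form y (simpleRoot s) ≤ 0 := by
  refine and_congr_right fun hy => and_congr_right fun hyJ => ⟨fun h s _ => h s, fun h s => ?_⟩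
  by_cases hs : s ∈ J
  · exact h s hs
  · exact G.form_simpleRoot_nonpos hy (hyJ s hs)

theorem IsPerronVector.mem_imaginaryChamber (hv : G.IsPerronVector v) :
    v ∈ G.imaginaryChamber Set.univ :=
  ⟨fun s => (hv.pos s).le, by simp, fun s => (hv.form_simpleRoot_neg s).le⟩

theorem exists_add_smul_mem_imaginaryChamber {y d : S → ℝ} (hyJ : ∀ s ∉ J, y s = 0)
    (hdJ : ∀ s ∉ J, d s = 0) (hy : ∀ s ∈ J, 0 < y s)
    (hyα : ∀ s ∈ J, G.form y (simpleRoot s) < 0) :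
    ∃ ε : ℝ, 0 < ε ∧ y + ε • d ∈ G.imaginaryChamber J := by
  obtain ⟨ε, hε, hpos⟩ := exists_pos_forall_add_mul_pos (ι := J ⊕ J)
    (a := Sum.elim (fun s => y s) fun s => -G.form y (simpleRoot s))
    (by rintro (s | s); exacts [hy s s.2, neg_pos.2 (hyα s s.2)])
    (Sum.elim (fun s => d s) fun s => -G.form d (simpleRoot s))
  refine ⟨ε, hε, mem_imaginaryChamber_iff.2 ⟨fun s => ?_, fun s hs => ?_, fun s hs => ?_⟩⟩
  · by_cases hs : s ∈ J
    · exact (hpos (.inl ⟨s, hs⟩)).le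
    · simp [hyJ s hs, hdJ s hs]
  · simp [hyJ s hs, hdJ s hs]
  · have hs' : 0 < -G.form y (simpleRoot s) + ε * -G.form d (simpleRoot s) :=
      hpos (.inr ⟨s, hs⟩)
    simp only [map_add, map_smul, LinearMap.add_apply, LinearMap.smul_apply, smul_eq_mul]
    linarith

theorem form_pos_of_forall_imaginaryChamber {y z : S → ℝ} (hyJ : ∀ s ∉ J, y s = 0)
    (hy : ∀ s ∈ J, 0 < y s) (hyα : ∀ s ∈ J, G.form y (simpleRoot s) < 0)
    (hz : ∀ u ∈ G.imaginaryChamber J, 0 ≤ G.form u z)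
    (hzJ : ∃ s ∈ J, G.form z (simpleRoot s) ≠ 0) : 0 < G.form y z := by
  obtain ⟨s, hs, hzs⟩ := hzJ
  have hdJ : ∀ t ∉ J, (-G.form z (simpleRoot s) • simpleRoot s) t = 0 := fun t ht => by
    simp [simpleRoot, Pi.single_eq_of_ne (ne_of_mem_of_not_mem hs ht).symm]
  obtain ⟨ε, hε, hmem⟩ := exists_add_smul_mem_imaginaryChamber hyJ hdJ hy hyα
  have hnonneg := hz _ hmem
  simp only [map_add, map_smul, LinearMap.add_apply, LinearMap.smul_apply, smul_eq_mul,
    G.form_comm (simpleRoot s) z] at hnonneg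
  nlinarith [mul_pos hε (mul_self_pos.2 hzs)]

end ImaginaryChamber

variable {W : Type*} [Group W] (cs : CoxeterSystem G.M W)

section Weights

theorem fundamentalWeight_mem_weights (s : S) : G.fundamentalWeight s ∈ weights cs :=
  ⟨1, s, (geometricRep_one_apply cs _).symm⟩

theorem fundamentalWeight_mem_spaceLikeWeights {s : S}
    (hs : 0 < G.form (G.fundamentalWeight s) (G.fundamentalWeight s)) :
    G.fundamentalWeight s ∈ spaceLikeWeights cs :=
  ⟨fundamentalWeight_mem_weights cs s, hs⟩

theorem geometricRep_mem_weights (w : W) {ω : S → ℝ} (hω : ω ∈ weights cs) :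
    geometricRep cs w ω ∈ weights cs := by
  obtain ⟨w', s, rfl⟩ := hω
  exact ⟨w * w', s, (geometricRep_mul_apply cs _ _ _).symm⟩

theorem geometricRep_mem_spaceLikeWeights (w : W) {ω : S → ℝ} (hω : ω ∈ spaceLikeWeights cs) :
    geometricRep cs w ω ∈ spaceLikeWeights cs :=
  ⟨geometricRep_mem_weights cs w hω.1, by rw [form_geometricRep]; exact hω.2⟩

theorem simpleReflection_mem_spaceLikeWeights (t : S) {ω : S → ℝ}
    (hω : ω ∈ spaceLikeWeights cs) : G.simpleReflection t ω ∈ spaceLikeWeights cs := by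
  rw [← geometricRep_simple cs]
  exact geometricRep_mem_spaceLikeWeights cs _ hω

theorem geometricRep_mem_titsCone (w : W) {x : S → ℝ} (hx : x ∈ titsCone cs) :
    geometricRep cs w x ∈ titsCone cs :=
  map_mem_closure_hull (L := (geometricRep cs w).toLinearMap)
    (LinearMap.continuous_of_finiteDimensional _)
    (fun _ hz => geometricRep_mem_weights cs w hz) hx

theorem geometricRep_simple_fundamentalWeight (hlor : G.IsLorentzian) {s t : S} (hts : t ≠ s) :
    geometricRep cs (cs.simple t) (G.fundamentalWeight s) = G.fundamentalWeight s := by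
  rw [geometricRep_simple, simpleReflection_apply, hlor.form_fundamentalWeight_simpleRoot,
    if_neg (by tauto)]
  simp

theorem geometricRep_mem_pastCone (hlor : G.IsLorentzian) [Nonempty S] (hv : G.IsPerronVector v)
    (w : W) {x : S → ℝ} (hx : x ∈ pastCone G.form v) :
    geometricRep cs w x ∈ pastCone G.form v := by
  induction w using cs.simple_induction_left with
  | one => simpa [geometricRep_one_apply] using hx
  | mul_simple_left w s ih =>
    rw [geometricRep_mul_apply, geometricRep_simple]
    have horient : G.form (G.simpleReflection s v) v ≤ 0 := by
      rw [simpleReflection_apply, map_sub, map_smul, LinearMap.sub_apply, LinearMap.smul_apply,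
        smul_eq_mul, G.form_comm (simpleRoot s) v]
      nlinarith [hv.form_self_neg, mul_self_nonneg (G.form v (simpleRoot s))]
    refine hlor.isLorentzForm.mem_pastCone_of_form_nonneg hv.form_self_neg ?_ ?_ horient ?_
    · rw [form_simpleReflection]; exact ih.1
    · rw [form_simpleReflection]; exact hv.form_self_neg
    · rw [form_simpleReflection]; exact ih.2

end Weights

section Positivity

theorem form_nonneg_of_mem_weights (hlor : G.IsLorentzian) {J : Set S} {y ω : S → ℝ}
    (hy : y ∈ G.imaginaryChamber J) (hω : ω ∈ weights cs) : 0 ≤ G.form y ω := by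
  obtain ⟨w, s, rfl⟩ := hω
  have hle : geometricRep cs w (G.fundamentalWeight s) ≤ G.fundamentalWeight s :=
    geometricRep_le_self cs (fun t => by
      rw [hlor.form_fundamentalWeight_simpleRoot]; split_ifs <;> norm_num) w
  have hform := form_nonpos_of_forall_simpleRoot hy.2.2 (sub_nonneg.2 hle)
  rw [map_sub, hlor.form_fundamentalWeight] at hform
  have hys : 0 ≤ y s := hy.1 s
  linarith

theorem form_nonneg_of_mem_titsCone (hlor : G.IsLorentzian) {J : Set S} {x y : S → ℝ}
    (hy : y ∈ G.imaginaryChamber J) (hx : x ∈ titsCone cs) : 0 ≤ G.form y x :=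
  nonneg_of_mem_closure_hull (G.continuous_form_right y)
    (fun _ hω => form_nonneg_of_mem_weights cs hlor hy hω) hx

theorem form_pos_of_mem_titsCone (hlor : G.IsLorentzian) (hv : G.IsPerronVector v) {x : S → ℝ}
    (hx : x ∈ titsCone cs) (hx0 : x ≠ 0) : 0 < G.form x v := by
  rw [form_comm]
  refine form_pos_of_forall_imaginaryChamber (J := Set.univ) (by simp) (fun s _ => hv.pos s)
    (fun s _ => hv.form_simpleRoot_neg s)
    (fun u hu => form_nonneg_of_mem_titsCone cs hlor hu hx) ?_
  by_contra! h
  exact hx0 (hlor.eq_zero_of_forall_simpleRoot fun s => h s trivial)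

theorem form_pos_of_mem_spaceLikeWeights (hlor : G.IsLorentzian) (hv : G.IsPerronVector v)
    {ω : S → ℝ} (hω : ω ∈ spaceLikeWeights cs) : 0 < G.form ω v :=
  form_pos_of_mem_titsCone cs hlor hv (subset_closure_hull hω.1) (by rintro rfl; simpa using hω.2)

end Positivity

section Chamber

/-- The reflections in `J` preserve the dual cone and the form, so they cannot decrease the minimum
of `form a` on a level set of the quadratic form. -/
theorem exists_mem_dual_forall_mul_nonpos {O : Set (S → ℝ)} {J : Set S}
    (hO : ∀ t ∈ J, ∀ u ∈ O, G.simpleReflection t u ∈ O) {a : S → ℝ}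
    (ha : ∀ z ∈ PointedCone.dual G.form O, z ≠ 0 → 0 < G.form a z) {z : S → ℝ}
    (hz : z ∈ PointedCone.dual G.form O) :
    ∃ y ∈ PointedCone.dual G.form O, G.form y y = G.form z z ∧
      ∀ t ∈ J, G.form a (simpleRoot t) * G.form y (simpleRoot t) ≤ 0 := by
  obtain ⟨y, hy, hyz, hmin⟩ := exists_isMinOn_level
    (PointedCone.isClosed_dual fun x => G.continuous_form_right x)
    (fun c hc x hx => PointedCone.smul_mem _ hc hx) ha G.continuous_form_self hz
  refine ⟨y, hy, hyz, fun t ht => ?_⟩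
  have hty : G.simpleReflection t y ∈ PointedCone.dual G.form O := fun u hu => by
    rw [← G.form_simpleReflection t, simpleReflection_simpleReflection]
    exact hy (hO t ht u hu)
  have hle : G.form a y ≤ G.form a (G.simpleReflection t y) :=
    hmin ⟨hty, by rw [form_simpleReflection, hyz]⟩
  rw [simpleReflection_apply, map_sub, map_smul, smul_eq_mul] at hle
  linarith

end Chamber

section Projection

/-- The imaginary cone of the stabilizer of `ω_s`, enlarged by `±ω_s` so that its dual lies in the
orthogonal complement of `ω_s`. -/
def stabilizerImaginaryCone (s : S) : Set (S → ℝ) :=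
  {G.fundamentalWeight s, -G.fundamentalWeight s} ∪
    {u | ∃ w : W, geometricRep cs w (G.fundamentalWeight s) = G.fundamentalWeight s ∧
      ∃ y ∈ G.imaginaryChamber {s}ᶜ, geometricRep cs w y = u}

theorem imaginaryChamber_subset_stabilizerImaginaryCone (s : S) :
    G.imaginaryChamber {s}ᶜ ⊆ stabilizerImaginaryCone cs s := fun y hy =>
  .inr ⟨1, geometricRep_one_apply cs _, y, hy, geometricRep_one_apply cs y⟩

theorem simpleReflection_mem_stabilizerImaginaryCone (hlor : G.IsLorentzian) {s t : S}
    (hts : t ≠ s) {u : S → ℝ} (hu : u ∈ stabilizerImaginaryCone cs s) :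
    G.simpleReflection t u ∈ stabilizerImaginaryCone cs s := by
  have hfix := geometricRep_simple_fundamentalWeight cs hlor hts
  rw [← geometricRep_simple cs]
  rcases hu with (rfl | rfl) | ⟨w, hw, y, hy, rfl⟩
  · exact .inl (.inl hfix)
  · exact .inl (.inr (by rw [map_neg, hfix]; rfl))
  · exact .inr ⟨cs.simple t * w, by rw [geometricRep_mul_apply, hw, hfix], y, hy,
      geometricRep_mul_apply cs _ _ _⟩

theorem form_fundamentalWeight_eq_zero_of_mem_dual {s : S} {z : S → ℝ}
    (hz : z ∈ PointedCone.dual G.form (stabilizerImaginaryCone cs s)) :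
    G.form z (G.fundamentalWeight s) = 0 := by
  have hpos : 0 ≤ G.form (G.fundamentalWeight s) z := hz (.inl (.inl rfl))
  have hneg : 0 ≤ G.form (-G.fundamentalWeight s) z := hz (.inl (.inr rfl))
  rw [map_neg, LinearMap.neg_apply] at hneg
  rw [form_comm]
  linarith

theorem orthProj_mem_dual_stabilizerImaginaryCone (hlor : G.IsLorentzian) {s : S}
    (hs : 0 < G.form (G.fundamentalWeight s) (G.fundamentalWeight s)) {x : S → ℝ}
    (hx : x ∈ titsCone cs) : orthProj G.form (G.fundamentalWeight s) x ∈
      PointedCone.dual G.form (stabilizerImaginaryCone cs s) := by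
  have horth := form_orthProj hs.ne' x
  rw [form_comm] at horth
  rintro u ((rfl | rfl) | ⟨w, hw, y, hy, rfl⟩)
  · exact horth.ge
  · simp [horth]
  · have hωy : G.form (geometricRep cs w y) (G.fundamentalWeight s) = 0 := by
      rw [← hw, form_geometricRep, hlor.form_fundamentalWeight, hy.2.1 s (by simp)]
    rw [← form_eq_form_orthProj hωy, form_geometricRep_left]
    exact form_nonneg_of_mem_titsCone cs hlor hy (geometricRep_mem_titsCone cs _ hx)

theorem eq_sum_smul_orthProj_fundamentalWeight (hlor : G.IsLorentzian) {s : S}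
    (hs : 0 < G.form (G.fundamentalWeight s) (G.fundamentalWeight s)) {z : S → ℝ}
    (hz : G.form z (G.fundamentalWeight s) = 0) :
    z = ∑ t ∈ Finset.univ.erase s, G.form z (simpleRoot t) •
      orthProj G.form (G.fundamentalWeight s) (G.fundamentalWeight t) := by
  have hself : orthProj G.form (G.fundamentalWeight s) (G.fundamentalWeight s) = 0 := by
    rw [orthProj_apply, div_self hs.ne', one_smul, sub_self]
  rw [Finset.sum_erase _ (by rw [hself, smul_zero])]
  calc z = orthProj G.form (G.fundamentalWeight s) z := by simp [orthProj_apply, hz]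
    _ = _ := by
      conv_lhs => rw [hlor.eq_sum_smul_fundamentalWeight z, map_sum]
      simp only [map_smul]

theorem orthProj_fundamentalWeight_fundamentalWeight_mem_pastCone (hlor : G.IsLorentzian)
    (h : G.LevelLE 2) (hv : G.IsPerronVector v) {s r : S}
    (hs : 0 < G.form (G.fundamentalWeight s) (G.fundamentalWeight s)) (hrs : r ≠ s) :
    orthProj G.form (G.fundamentalWeight s) (G.fundamentalWeight r) ∈ pastCone G.form v := by
  have : Nonempty S := ⟨s⟩
  obtain ⟨y, hy, hys, hypos, -, hyy⟩ := exists_perronFrobenius_of_spaceLike hlor h hs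
  have hyω : G.form y (G.fundamentalWeight s) = 0 := by rw [hlor.form_fundamentalWeight, hys]
  refine hlor.isLorentzForm.mem_pastCone_of_form_nonneg hv.form_self_neg
    (form_orthProj_fundamentalWeight_nonpos hlor h hs hrs) hyy (hv.form_nonpos hy) ?_
  rw [form_comm, ← form_eq_form_orthProj hyω, hlor.form_fundamentalWeight]
  exact (hypos r hrs).le

theorem mem_pastCone_of_orthogonal_of_forall_nonneg (hlor : G.IsLorentzian) (h : G.LevelLE 2)
    (hv : G.IsPerronVector v) {s : S}
    (hs : 0 < G.form (G.fundamentalWeight s) (G.fundamentalWeight s)) {z : S → ℝ}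
    (hz : G.form z (G.fundamentalWeight s) = 0)
    (hzα : ∀ t ≠ s, 0 ≤ G.form z (simpleRoot t)) : z ∈ pastCone G.form v := by
  have : Nonempty S := ⟨s⟩
  rw [eq_sum_smul_orthProj_fundamentalWeight hlor hs hz]
  refine Finset.sum_induction _ (· ∈ pastCone G.form v)
    (fun _ _ => hlor.isLorentzForm.add_mem_pastCone hv.form_self_neg) (by simp [pastCone])
    fun t ht => ?_
  have hts := Finset.ne_of_mem_erase ht
  exact IsLorentzForm.smul_mem_pastCone (hzα t hts)
    (orthProj_fundamentalWeight_fundamentalWeight_mem_pastCone hlor h hv hs hts)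

theorem form_pos_of_mem_dual_stabilizerImaginaryCone (hlor : G.IsLorentzian) {s : S}
    (hs : 0 < G.form (G.fundamentalWeight s) (G.fundamentalWeight s)) {y z : S → ℝ}
    (hys : y s = 0) (hy : ∀ t ≠ s, 0 < y t) (hyα : ∀ t ≠ s, G.form y (simpleRoot t) < 0)
    (hz : z ∈ PointedCone.dual G.form (stabilizerImaginaryCone cs s)) (hz0 : z ≠ 0) :
    0 < G.form y z := by
  refine form_pos_of_forall_imaginaryChamber (J := {s}ᶜ) (by simpa using hys) hy hyα
    (fun u hu => hz (imaginaryChamber_subset_stabilizerImaginaryCone cs s hu)) ?_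
  by_contra! hzα
  refine hz0 ?_
  rw [eq_sum_smul_orthProj_fundamentalWeight hlor hs
    (form_fundamentalWeight_eq_zero_of_mem_dual cs hz)]
  exact Finset.sum_eq_zero fun t ht => by rw [hzα t (Finset.ne_of_mem_erase ht), zero_smul]

theorem mem_pastCone_of_mem_dual_stabilizerImaginaryCone (hlor : G.IsLorentzian)
    (h : G.LevelLE 2) (hv : G.IsPerronVector v) {s : S}
    (hs : 0 < G.form (G.fundamentalWeight s) (G.fundamentalWeight s)) {z : S → ℝ}
    (hz : z ∈ PointedCone.dual G.form (stabilizerImaginaryCone cs s)) :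
    z ∈ pastCone G.form v := by
  have : Nonempty S := ⟨s⟩
  obtain ⟨y, hy, hys, hypos, hyα, hyy⟩ := exists_perronFrobenius_of_spaceLike hlor h hs
  have hpos : ∀ z ∈ PointedCone.dual G.form (stabilizerImaginaryCone cs s), z ≠ 0 →
      0 < G.form y z := fun z hz hz0 =>
    form_pos_of_mem_dual_stabilizerImaginaryCone cs hlor hs hys hypos hyα hz hz0
  obtain ⟨z', hz', hnorm, hz'α⟩ := exists_mem_dual_forall_mul_nonpos (J := {s}ᶜ)
    (fun t hts u hu => simpleReflection_mem_stabilizerImaginaryCone cs hlor hts hu) hpos hz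
  have hz'past : z' ∈ pastCone G.form v :=
    mem_pastCone_of_orthogonal_of_forall_nonneg hlor h hv hs
      (form_fundamentalWeight_eq_zero_of_mem_dual cs hz') fun t hts =>
        nonneg_of_mul_nonpos_right (hz'α t hts) (hyα t hts)
  have hzy : 0 ≤ G.form z y := by
    rcases eq_or_ne z 0 with rfl | hz0
    · simp
    · rw [form_comm]; exact (hpos z hz hz0).le
  exact hlor.isLorentzForm.mem_pastCone_of_form_nonneg hv.form_self_neg
    (hnorm ▸ hz'past.1) hyy (hv.form_nonpos hy) hzy

theorem geometricRep_orthProj (w : W) (x y : S → ℝ) :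
    geometricRep cs w (orthProj G.form x y) =
      orthProj G.form (geometricRep cs w x) (geometricRep cs w y) := by
  simp only [orthProj_apply, map_sub, map_smul, form_geometricRep]

theorem orthProj_mem_pastCone (hlor : G.IsLorentzian) (h : G.LevelLE 2)
    (hv : G.IsPerronVector v) {ω : S → ℝ} (hω : ω ∈ spaceLikeWeights cs) {x : S → ℝ}
    (hx : x ∈ titsCone cs) : orthProj G.form ω x ∈ pastCone G.form v := by
  obtain ⟨⟨w, s, rfl⟩, hpos⟩ := hω
  have : Nonempty S := ⟨s⟩
  rw [form_geometricRep] at hpos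
  have hmem := geometricRep_mem_pastCone cs hlor hv w
    (mem_pastCone_of_mem_dual_stabilizerImaginaryCone cs hlor h hv hpos
      (orthProj_mem_dual_stabilizerImaginaryCone cs hlor hpos
        (geometricRep_mem_titsCone cs w⁻¹ hx)))
  rwa [geometricRep_orthProj, ← geometricRep_mul_apply, mul_inv_cancel,
    geometricRep_one_apply] at hmem

end Projection

section Duality

theorem simpleReflection_mem_hull (t : S) {x : S → ℝ}
    (hx : x ∈ PointedCone.hull ℝ (spaceLikeWeights cs)) :
    G.simpleReflection t x ∈ PointedCone.hull ℝ (spaceLikeWeights cs) :=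
  map_mem_hull (L := (G.simpleReflection t).toLinearMap)
    (fun _ hω => simpleReflection_mem_spaceLikeWeights cs t hω) hx

theorem exists_mem_hull_form_simpleRoot_pos_of_adj {a b : S} (hab : G.coxeterGraph.Adj a b)
    {x : S → ℝ} (hx : x ∈ PointedCone.hull ℝ (spaceLikeWeights cs))
    (hxα : ∀ u, 0 ≤ G.form x (simpleRoot u)) (hxa : 0 < G.form x (simpleRoot a)) :
    ∃ y ∈ PointedCone.hull ℝ (spaceLikeWeights cs),
      (∀ u, 0 ≤ G.form y (simpleRoot u)) ∧ 0 < G.form y (simpleRoot b) := by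
  have hform : ∀ u, G.form (x + (1 / 2 : ℝ) • G.simpleReflection a x) (simpleRoot u) =
      3 / 2 * G.form x (simpleRoot u) - G.form x (simpleRoot a) * G.gram a u := fun u => by
    rw [simpleReflection_apply]
    simp only [map_add, map_sub, map_smul, LinearMap.add_apply, LinearMap.sub_apply,
      LinearMap.smul_apply, smul_eq_mul, form_simpleRoot]
    ring
  refine ⟨x + (1 / 2 : ℝ) • G.simpleReflection a x, add_mem hx
    (PointedCone.smul_mem _ (by norm_num) (simpleReflection_mem_hull cs a hx)), fun u => ?_, ?_⟩
  · rw [hform]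
    rcases eq_or_ne a u with rfl | hau
    · rw [gram_self]; linarith
    · linarith [hxα u, mul_nonpos_of_nonneg_of_nonpos hxa.le (G.gram_nonpos hau)]
  · rw [hform]
    linarith [hxα b, mul_neg_of_pos_of_neg hxa (G.gram_neg_of_adj hab)]

theorem exists_mem_hull_forall_form_simpleRoot_pos (hirr : G.IsIrreducible)
    (hlor : G.IsLorentzian) (hsl : (spaceLikeWeights cs).Nonempty) :
    ∃ x ∈ PointedCone.hull ℝ (spaceLikeWeights cs), ∀ t, 0 < G.form x (simpleRoot t) := by
  obtain ⟨_, ⟨w, s, rfl⟩, hpos⟩ := hsl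
  rw [form_geometricRep] at hpos
  have hstart : ∃ x ∈ PointedCone.hull ℝ (spaceLikeWeights cs),
      (∀ u, 0 ≤ G.form x (simpleRoot u)) ∧ 0 < G.form x (simpleRoot s) :=
    ⟨G.fundamentalWeight s,
      PointedCone.subset_hull (fundamentalWeight_mem_spaceLikeWeights cs hpos),
      fun u => by rw [hlor.form_fundamentalWeight_simpleRoot]; split_ifs <;> norm_num,
      by simp [hlor.form_fundamentalWeight_simpleRoot]⟩
  have hreach : ∀ t, ∃ x ∈ PointedCone.hull ℝ (spaceLikeWeights cs),
      (∀ u, 0 ≤ G.form x (simpleRoot u)) ∧ 0 < G.form x (simpleRoot t) := fun t => by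
    have hst := (SimpleGraph.reachable_iff_reflTransGen s t).1 (hirr.preconnected s t)
    induction hst with
    | refl => exact hstart
    | tail _ hadj ih =>
      obtain ⟨x, hx, hxα, hxa⟩ := ih
      exact exists_mem_hull_form_simpleRoot_pos_of_adj cs hadj hx hxα hxa
  choose x hx hxα hxt using hreach
  refine ⟨∑ t, x t, sum_mem fun t _ => hx t, fun t => ?_⟩
  rw [map_sum, LinearMap.sum_apply]
  exact Finset.sum_pos' (fun u _ => hxα u t) ⟨t, Finset.mem_univ t, hxt t⟩

theorem span_spaceLikeWeights (hirr : G.IsIrreducible) (hlor : G.IsLorentzian)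
    (hsl : (spaceLikeWeights cs).Nonempty) : Submodule.span ℝ (spaceLikeWeights cs) = ⊤ := by
  obtain ⟨x, hx, hxα⟩ := exists_mem_hull_forall_form_simpleRoot_pos cs hirr hlor hsl
  have hhull : ∀ y ∈ PointedCone.hull ℝ (spaceLikeWeights cs),
      y ∈ Submodule.span ℝ (spaceLikeWeights cs) := fun y hy =>
    Submodule.span_subset_span {c : ℝ // 0 ≤ c} ℝ _ hy
  have hroot : ∀ t, simpleRoot t ∈ Submodule.span ℝ (spaceLikeWeights cs) := fun t => by
    have hdiff := sub_mem (hhull x hx) (hhull _ (simpleReflection_mem_hull cs t hx))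
    rw [simpleReflection_apply, sub_sub_cancel] at hdiff
    exact (Submodule.smul_mem_iff _ (mul_pos two_pos (hxα t)).ne').1 hdiff
  refine (Submodule.eq_top_iff').2 fun y => ?_
  rw [eq_sum_smul_simpleRoot y]
  exact sum_mem fun t _ => Submodule.smul_mem _ _ (hroot t)

theorem exists_forall_mem_dual_form_pos (hirr : G.IsIrreducible) (hlor : G.IsLorentzian)
    (hsl : (spaceLikeWeights cs).Nonempty) :
    ∃ a, (∀ t, 0 < G.form a (simpleRoot t)) ∧
      ∀ z ∈ PointedCone.dual G.form (spaceLikeWeights cs), z ≠ 0 → 0 < G.form a z := by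
  obtain ⟨x₀, hx₀, hx₀α⟩ := exists_mem_hull_forall_form_simpleRoot_pos cs hirr hlor hsl
  obtain ⟨x₁, -, hx₁⟩ := exists_mem_hull_forall_pos (span_spaceLikeWeights cs hirr hlor hsl)
  obtain ⟨ε, hε, hpos⟩ :=
    exists_pos_forall_add_mul_pos hx₀α fun t => G.form x₁ (simpleRoot t)
  refine ⟨x₀ + ε • x₁, fun t => by simpa using hpos t, fun z hz hz0 => ?_⟩
  have hz' : ∀ ω ∈ spaceLikeWeights cs, 0 ≤ G.form z ω := fun ω hω => by
    rw [form_comm]; exact hz hω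
  have hzform : G.form z ≠ 0 := fun hzero =>
    hz0 (hlor.isLorentzForm.eq_zero_of_forall fun y => by rw [hzero, LinearMap.zero_apply])
  have hzx₀ : 0 ≤ G.form z x₀ := nonneg_of_mem_hull hz' hx₀
  have hzx₁ := mul_pos hε (hx₁ _ hz' hzform)
  rw [form_comm, map_add, map_smul, smul_eq_mul]
  linarith

theorem nonneg_of_mem_dual_of_forall_simpleRoot (hlor : G.IsLorentzian)
    (hv : G.IsPerronVector v) {y : S → ℝ}
    (hy : y ∈ PointedCone.dual G.form (spaceLikeWeights cs))
    (hyα : ∀ s, G.form y (simpleRoot s) ≤ 0) : 0 ≤ y := fun r => by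
  have : Nonempty S := ⟨r⟩
  rw [Pi.zero_apply, ← hlor.form_fundamentalWeight y r]
  by_cases hr : 0 < G.form (G.fundamentalWeight r) (G.fundamentalWeight r)
  · rw [form_comm]
    exact hy (fundamentalWeight_mem_spaceLikeWeights cs hr)
  · simpa using form_nonpos_of_forall_simpleRoot hyα
      (neg_nonneg.2 (fundamentalWeight_nonpos hlor hv (not_lt.1 hr)))

theorem form_self_nonpos_of_mem_dual (hirr : G.IsIrreducible) (hlor : G.IsLorentzian)
    (hsl : (spaceLikeWeights cs).Nonempty) (hv : G.IsPerronVector v) {z : S → ℝ}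
    (hz : z ∈ PointedCone.dual G.form (spaceLikeWeights cs)) : G.form z z ≤ 0 := by
  obtain ⟨a, haα, hapos⟩ := exists_forall_mem_dual_form_pos cs hirr hlor hsl
  obtain ⟨y, hy, hnorm, hyα⟩ := exists_mem_dual_forall_mul_nonpos (J := Set.univ)
    (fun t _ _ hω => simpleReflection_mem_spaceLikeWeights cs t hω) hapos hz
  have hyα' : ∀ s, G.form y (simpleRoot s) ≤ 0 := fun s =>
    nonpos_of_mul_nonpos_right (hyα s trivial) (haα s)
  rw [← hnorm]
  exact form_nonpos_of_forall_simpleRoot hyα'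
    (nonneg_of_mem_dual_of_forall_simpleRoot cs hlor hv hy hyα')

theorem neg_mem_pastCone_of_mem_dual (hirr : G.IsIrreducible) (hlor : G.IsLorentzian)
    (hsl : (spaceLikeWeights cs).Nonempty) (hv : G.IsPerronVector v) {y : S → ℝ}
    (hy : y ∈ PointedCone.dual G.form (spaceLikeWeights cs)) : -y ∈ pastCone G.form v := by
  have := hlor.nonempty
  have hvv := hv.form_self_neg
  refine ⟨by simpa using form_self_nonpos_of_mem_dual cs hirr hlor hsl hv hy, ?_⟩
  rw [map_neg, LinearMap.neg_apply, neg_nonneg]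
  by_contra! hyv
  have hproj : orthProj G.form v y ∈ PointedCone.dual G.form (spaceLikeWeights cs) := by
    rw [orthProj_apply, sub_eq_add_neg, ← neg_smul]
    exact add_mem hy (PointedCone.smul_mem _ (neg_nonneg.2 (div_neg_of_pos_of_neg hyv hvv).le)
      fun ω hω => by
        rw [form_comm]
        exact form_nonneg_of_mem_weights cs hlor hv.mem_imaginaryChamber hω.1)
  have hproj0 : orthProj G.form v y = 0 := hlor.isLorentzForm.eq_zero_of_orthogonal hvv
    (by rw [form_comm]; exact form_orthProj hvv.ne y)
    (form_self_nonpos_of_mem_dual cs hirr hlor hsl hv hproj)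
  obtain ⟨ω, hω⟩ := hsl
  have hωy : 0 ≤ G.form ω y := hy hω
  rw [eq_smul_add_orthProj G.form v y, hproj0, add_zero, map_smul, smul_eq_mul] at hωy
  exact hωy.not_gt (mul_neg_of_neg_of_pos (div_neg_of_pos_of_neg hyv hvv)
    (form_pos_of_mem_spaceLikeWeights cs hlor hv hω))

theorem pastCone_subset_closure_hull (hirr : G.IsIrreducible) (hlor : G.IsLorentzian)
    (hsl : (spaceLikeWeights cs).Nonempty) (hv : G.IsPerronVector v) :
    pastCone G.form v ⊆ (PointedCone.hull ℝ (spaceLikeWeights cs)).closure := by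
  have := hlor.nonempty
  intro x hx
  by_contra hxT
  let T : ProperCone ℝ (S → ℝ) :=
    ⟨(PointedCone.hull ℝ (spaceLikeWeights cs)).closure, isClosed_closure⟩
  obtain ⟨f, hf, hfx⟩ := T.hyperplane_separation_point (x₀ := x) hxT
  obtain ⟨y, hy⟩ := hlor.isLorentzForm.exists_form_eq (f : (S → ℝ) →ₗ[ℝ] ℝ)
  have hydual : y ∈ PointedCone.dual G.form (spaceLikeWeights cs) := fun ω hω => by
    rw [form_comm, hy]
    exact hf ω (subset_closure_hull hω)
  have hyx := hlor.isLorentzForm.form_nonpos_of_mem_pastCone hv.form_self_neg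
    (neg_mem_pastCone_of_mem_dual cs hirr hlor hsl hv hydual) hx
  rw [map_neg, LinearMap.neg_apply, hy, neg_nonpos] at hyx
  exact hfx.not_ge hyx

theorem mem_pastCone_of_mem_weights (hlor : G.IsLorentzian) (hv : G.IsPerronVector v)
    {ω : S → ℝ} (hω : ω ∈ weights cs) (hωω : G.form ω ω ≤ 0) : ω ∈ pastCone G.form v := by
  obtain ⟨w, r, rfl⟩ := hω
  have : Nonempty S := ⟨r⟩
  rw [form_geometricRep] at hωω
  refine geometricRep_mem_pastCone cs hlor hv w ⟨hωω, ?_⟩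
  rw [form_comm, hlor.form_fundamentalWeight]
  exact (hv.pos r).le

theorem titsCone_eq_closure_hull (hirr : G.IsIrreducible) (hlor : G.IsLorentzian)
    (hsl : (spaceLikeWeights cs).Nonempty) (hv : G.IsPerronVector v) :
    titsCone cs = (PointedCone.hull ℝ (spaceLikeWeights cs)).closure := by
  refine le_antisymm (closure_hull_le isClosed_closure fun ω hω => ?_)
    (closure_hull_le isClosed_closure fun ω hω => subset_closure_hull hω.1)
  by_cases hωω : 0 < G.form ω ω
  · exact subset_closure_hull ⟨hω, hωω⟩
  · exact pastCone_subset_closure_hull cs hirr hlor hsl hv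
      (mem_pastCone_of_mem_weights cs hlor hv hω (not_lt.1 hωω))

end Duality

theorem isLorentzPolytope (hirr : G.IsIrreducible) (hlor : G.IsLorentzian) (h : G.LevelLE 2)
    (hsl : (spaceLikeWeights cs).Nonempty) (hv : G.IsPerronVector v) :
    IsLorentzPolytope G.form v (spaceLikeWeights cs) (titsCone cs) where
  isLorentzForm := hlor.isLorentzForm
  form_self_neg := have := hlor.nonempty; hv.form_self_neg
  form_self_pos _ hω := hω.2
  eq_closure_hull := titsCone_eq_closure_hull cs hirr hlor hsl hv
  pastCone_subset := by
    rw [titsCone_eq_closure_hull cs hirr hlor hsl hv]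
    exact pastCone_subset_closure_hull cs hirr hlor hsl hv
  form_pos _ hx hx0 := form_pos_of_mem_titsCone cs hlor hv hx hx0
  orthProj_mem _ hω _ hx := orthProj_mem_pastCone cs hlor h hv hω hx

section Infinite

theorem IsLorentzian.eq_zero_of_forall_simpleReflection (hlor : G.IsLorentzian) {x : S → ℝ}
    (hx : ∀ s, G.simpleReflection s x = x) : x = 0 :=
  hlor.eq_zero_of_forall_simpleRoot fun s => by
    have hs := hx s
    rw [simpleReflection_apply, sub_eq_self] at hs
    simpa [simpleRoot] using congrFun hs s

theorem spaceLikeWeights_infinite (hlor : G.IsLorentzian)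
    (hsl : (spaceLikeWeights cs).Nonempty) (hv : G.IsPerronVector v) :
    (spaceLikeWeights cs).Infinite := by
  intro hfin
  have hsum : ∑ ω ∈ hfin.toFinset, ω = 0 :=
    hlor.eq_zero_of_forall_simpleReflection fun s => by
      rw [map_sum]
      refine Finset.sum_equiv (G.simpleReflection s).toEquiv (fun ω => ?_) fun _ _ => rfl
      rw [hfin.mem_toFinset, hfin.mem_toFinset]
      refine ⟨simpleReflection_mem_spaceLikeWeights cs s, fun hω => ?_⟩
      rw [← G.simpleReflection_simpleReflection s ω]
      exact simpleReflection_mem_spaceLikeWeights cs s hω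
  have hpos : 0 < G.form (∑ ω ∈ hfin.toFinset, ω) v := by
    rw [map_sum, LinearMap.sum_apply]
    exact Finset.sum_pos (fun ω hω =>
      form_pos_of_mem_spaceLikeWeights cs hlor hv (hfin.mem_toFinset.1 hω))
      (hfin.toFinset_nonempty.2 hsl)
  rw [hsum] at hpos
  simp at hpos

theorem eq_of_mk_eq_mk_of_form_self_eq (hlor : G.IsLorentzian) (hv : G.IsPerronVector v)
    {ω ω' : S → ℝ} (hω : ω ∈ spaceLikeWeights cs) (hω' : ω' ∈ spaceLikeWeights cs)
    (hω0 : ω ≠ 0) (hω'0 : ω' ≠ 0) (hnorm : G.form ω ω = G.form ω' ω')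
    (hmk : Projectivization.mk ℝ ω hω0 = Projectivization.mk ℝ ω' hω'0) : ω = ω' := by
  obtain ⟨c, rfl⟩ := (Projectivization.mk_eq_mk_iff' ℝ _ _ _ _).1 hmk
  have hωv := form_pos_of_mem_spaceLikeWeights cs hlor hv hω
  simp only [map_smul, LinearMap.smul_apply, smul_eq_mul] at hnorm hωv
  have hc : 0 < c :=
    pos_of_mul_pos_left hωv (form_pos_of_mem_spaceLikeWeights cs hlor hv hω').le
  have hsq : c * c = 1 := by
    rw [← mul_assoc] at hnorm
    exact mul_right_cancel₀ hω'.2.ne' (by rw [hnorm, one_mul])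
  rw [show c = 1 by nlinarith, one_smul]

theorem projSet_spaceLikeWeights_infinite (hlor : G.IsLorentzian)
    (hsl : (spaceLikeWeights cs).Nonempty) (hv : G.IsPerronVector v) :
    (projSet (spaceLikeWeights cs)).Infinite := by
  intro hfin
  have hω0 : ∀ ω : spaceLikeWeights cs, (ω : S → ℝ) ≠ 0 := fun ω hzero => by
    simpa [hzero] using ω.2.2
  choose s hs using fun ω : spaceLikeWeights cs => (show ∃ s, G.form (ω : S → ℝ) ω =
      G.form (G.fundamentalWeight s) (G.fundamentalWeight s) by
    obtain ⟨_, ⟨w, s, rfl⟩, _⟩ := ω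
    exact ⟨s, form_geometricRep cs w _ _⟩)
  have := hfin.to_subtype
  have hfinite : Finite (spaceLikeWeights cs) :=
    Finite.of_injective (β := projSet (spaceLikeWeights cs) × S)
      (fun ω => (⟨Projectivization.mk ℝ ω (hω0 ω), ω, ω.2, hω0 ω, rfl⟩, s ω)) fun ω ω' heq => by
        obtain ⟨hmk, hsω⟩ := Prod.mk.inj heq
        exact Subtype.ext <| eq_of_mk_eq_mk_of_form_self_eq cs hlor hv ω.2 ω'.2 (hω0 ω) (hω0 ω')
          (by rw [hs, hs, hsω]) (Subtype.mk.inj hmk)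
  exact spaceLikeWeights_infinite cs hlor hsl hv (Set.toFinite _)

end Infinite

end GeometricCoxeterMatrix

end

/-- For an irreducible Lorentzian Coxeter system of level `2`, the projective Tits cone is an
edge-tangent infinite polytope whose `1`-skeleton is the tangency graph of the Boyd–Maxwell
packing. -/
theorem mainTheorem6 {S : Type*} [Fintype S] [DecidableEq S] (G : GeometricCoxeterMatrix S)
    {W : Type*} [Group W] (cs : CoxeterSystem G.M W)
    (hirr : G.IsIrreducible) (hlor : G.IsLorentzian) (hlev : G.IsOfLevel 2) :
    -- infinite polytope: infinitely many vertices, whose closed convex hull is everything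
    ((projVertices (GeometricCoxeterMatrix.titsCone cs)).Infinite ∧
      GeometricCoxeterMatrix.titsCone cs = (PointedCone.hull ℝ
        {x | ∃ hx : x ≠ 0, x ∈ GeometricCoxeterMatrix.titsCone cs ∧ Projectivization.mk ℝ x hx ∈
          projVertices (GeometricCoxeterMatrix.titsCone cs)}).closure) ∧
    -- every edge is tangent to the projective light cone: its line meets the projective light
    -- cone in exactly one point, and this point lies on the edge
    (∀ F : PointedCone ℝ (S → ℝ), IsProjEdge (GeometricCoxeterMatrix.titsCone cs) F →
      ∃ p ∈ projSet (F : Set (S → ℝ)),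
        projSet (Submodule.span ℝ (F : Set (S → ℝ)) : Set (S → ℝ)) ∩ projSet G.lightCone = {p}) ∧
    -- the tangency graph is the 1-skeleton, the ball of a weight `ω` being the vertex spanned by `ω`
    (∃ f : tangencyGraph (GeometricCoxeterMatrix.boydMaxwell cs) ≃g
        projSkeleton (GeometricCoxeterMatrix.titsCone cs),
      ∀ (ω : S → ℝ) (hω : ω ∈ GeometricCoxeterMatrix.spaceLikeWeights cs) (h0 : ω ≠ 0),
        (f ⟨G.ball ω, Set.mem_image_of_mem _ hω⟩ : ℙ ℝ (S → ℝ)) = Projectivization.mk ℝ ω h0) := by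
  have := hlor.nonempty
  have hlev₁ : ¬ G.LevelLE 1 := hlev.2 1 one_lt_two
  have hS : 3 ≤ Fintype.card S := GeometricCoxeterMatrix.three_le_card_of_not_levelLE_one hlev₁
  have hdim : 3 ≤ Module.finrank ℝ (S → ℝ) := by
    rwa [Module.finrank_fintype_fun_eq_card]
  obtain ⟨v, hv⟩ :=
    GeometricCoxeterMatrix.exists_isPerronVector hirr hlor.isLorentzForm.exists_neg
  obtain ⟨s, hs⟩ := GeometricCoxeterMatrix.exists_spaceLike_fundamentalWeight hlor hlev₁
  have hsl : (GeometricCoxeterMatrix.spaceLikeWeights cs).Nonempty :=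
    ⟨_, GeometricCoxeterMatrix.fundamentalWeight_mem_spaceLikeWeights cs hs⟩
  have hT := GeometricCoxeterMatrix.isLorentzPolytope cs hirr hlor hlev.1 hsl hv
  refine ⟨⟨?_, hT.eq_closure_hull_vertices⟩, fun F hF => hT.edge_tangent hdim hF, ?_⟩
  · rw [hT.projVertices_eq hdim]
    exact GeometricCoxeterMatrix.projSet_spaceLikeWeights_infinite cs hlor hsl hv
  · have hiso := hT.exists_iso_projSkeleton hdim
    rw [← GeometricCoxeterMatrix.ball_eq_cap hlor hS hv] at hiso
    exact hiso
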